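/- Let $q$ be a power of an odd prime $p$, let $m,e$ be positive integers such that $m/\gcd(m,e)$ is even, and write $m=2\ell$. Put $\epsilon=0$ if $\ell/\gcd(m,e)$ is odd and $\epsilon=\gcd(m,e)$ if $\ell/\gcd(m,e)$ is even. Let $m_p\in\mathbb{F}_p$ be the residue class of $m$ modulo $p$, and let $\mathrm{Tr}$ be the trace function from $\mathbb{F}_{q^m}$ to $\mathbb{F}_q$. Let $$D_3=\{x\in\mathbb{F}_{q^m}^*:\mathrm{Tr}(x^{q^e+1})=0\ \text{or}\ \mathrm{Tr}(x)=0\}=\{d_1,\dots,d_n\}$$ with $d_1,\dots,d_n$ distinct, and let $$\mathcal{C}_{D_3}=\{(\mathrm{Tr}(bd_1),\dots,\mathrm{Tr}(bd_n)):b\in\mathbb{F}_{q^m}\}\subseteq\mathbb{F}_q^n .$$ A code is called $t$-weight if exactly $t$ positive integers occur as Hamming weights of its codewords; an $[n,k,d]$ code over $\mathbb{F}_q$ is a $k$-dimensional subspace of $\mathbb{F}_q^n$ with minimum Hamming distance $d$. Assume that $m>3$, and that $m>2\epsilon+2$ if $m_p\neq0$. 1) If $m_p\neq0$, then $\mathcal{C}_{D_3}$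 is a $6$-weight linear code over $\mathbb{F}_q$ with parameters $$[(q-1)(q^{m-2}-q^{\ell+\epsilon-1})+q^{m-1}-1,\ m,\ (q-1)(q^{m-2}-q^{\ell+\epsilon-1})]$$ and with the following weight distribution (the listed weights are distinct and no other weight occurs): $$\begin{array}{ll} \text{Weight} & \text{Frequency}\\ 0 & 1\\ (q-1)(q^{m-2}-q^{\ell+\epsilon-1}) & q-1\\ (q-1)(2q^{m-2}-q^{m-3}) & q^{m-2\epsilon-2}-1\\ (q-1)(2q^{m-2}-q^{m-3}-q^{\ell+\epsilon-2}) & (q-1)(q^{m-2\epsilon-2}-q^{\ell-\epsilon-1})\\ (q-1)(2q^{m-2}-q^{m-3}-q^{\ell+\epsilon-1}) & (q-1)(q^{m-2\epsilon-2}-1)\\ (q-1)(2q^{m-2}-q^{m-3}-q^{\ell+\epsilon-1}-q^{\ell+\epsilon-2}) & \frac{q-1}{2}(q^{m-2\epsilon-1}-q^{\ell-\epsilon}+2q^{\ell-\epsilon-1}-2q^{m-2\epsilon-2})\\ (q-1)(2q^{m-2}-q^{m-3}-q^{\ell+\epsilon-1}+q^{\ell+\epsilon-2}) & q^m+\frac12(q^{\ell-\epsilon+1}-q^{m-2\epsilon}-q^{m-2\epsilon-1}-q^{\ell-\epsilon})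 \end{array}$$ 2) If $m_p=0$, then $\mathcal{C}_{D_3}$ is a $4$-weight linear code over $\mathbb{F}_q$ with parameters $$[(q-1)q^{m-2}+q^{m-1}-1,\ m,\ (q-1)q^{m-2}]$$ and with the following weight distribution (the listed weights are distinct and no other weight occurs): $$\begin{array}{ll} \text{Weight} & \text{Frequency}\\ 0 & 1\\ (q-1)q^{m-2} & q-1\\ (q-1)(2q^{m-2}-q^{m-3}+q^{\ell+\epsilon-1}-q^{\ell+\epsilon-2}) & (q-1)q^{m-2\epsilon-2}\\ (q-1)(2q^{m-2}-q^{m-3}-q^{\ell+\epsilon-2}) & (q-1)^2q^{m-2\epsilon-2}\\ (q-1)(2q^{m-2}-q^{m-3}) & q^m-q^{m-2\epsilon}+q^{m-2\epsilon-1}-q \end{array}$$ -/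

import Mathlib

/-- `E₁ = {x ∈ L* : Tr(x^(q^e+1)) = u}`, where `q = |K|` and `Tr` is the trace from `L` to `K`. -/
def setE1 (K L : Type*) [Field K] [Field L] [Algebra K L] (e : ℕ) (u : K) : Set L :=
  {x | x ≠ 0 ∧ Algebra.trace K L (x ^ (Nat.card K ^ e + 1)) = u}

/-- `E₂ = {x ∈ L* : Tr(x) = v}`. -/
def setE2 (K L : Type*) [Field K] [Field L] [Algebra K L] (v : K) : Set L :=
  {x | x ≠ 0 ∧ Algebra.trace K L x = v}

/-- `D₃ = E₁ ∪ E₂`. -/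
def setD3 (K L : Type*) [Field K] [Field L] [Algebra K L] (e : ℕ) (u v : K) : Set L :=
  setE1 K L e u ∪ setE2 K L v

/-- The linear map `b ↦ (Tr(b d₁), …, Tr(b dₙ))`. -/
noncomputable def traceEncode (K : Type*) {L : Type*} [Field K] [Field L] [Algebra K L]
    {n : ℕ} (d : Fin n → L) : L →ₗ[K] (Fin n → K) :=
  LinearMap.pi fun i => (Algebra.trace K L).comp (LinearMap.mulRight K (d i))

/-- The code `C_D = {(Tr(b d₁), …, Tr(b dₙ)) : b ∈ L}` of the defining set
`D = {d₁, …, dₙ}`, listed as `d`. -/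
noncomputable def traceCode (K : Type*) {L : Type*} [Field K] [Field L] [Algebra K L]
    {n : ℕ} (d : Fin n → L) : Submodule K (Fin n → K) :=
  LinearMap.range (traceEncode K d)

/-- `A_w`: the number of codewords of Hamming weight `w`. -/
noncomputable def weightCount {K : Type*} [Field K] [DecidableEq K] {n : ℕ}
    (C : Submodule K (Fin n → K)) (w : ℕ) : ℕ :=
  Set.ncard {c : Fin n → K | c ∈ C ∧ hammingNorm c = w}

/-- `C` is a `t`-weight code: exactly `t` of the numbers `A_1, A_2, …` are nonzero. -/
def IsTWeight {K : Type*} [Field K] [DecidableEq K] {n : ℕ}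
    (C : Submodule K (Fin n → K)) (t : ℕ) : Prop :=
  Set.ncard {w : ℕ | 1 ≤ w ∧ weightCount C w ≠ 0} = t

/-- `δ` is the minimum Hamming distance of `C` (so `C` has two distinct codewords). -/
def IsMinDistance {K : Type*} [Field K] [DecidableEq K] {n : ℕ}
    (C : Submodule K (Fin n → K)) (δ : ℚ) : Prop :=
  IsLeast {r : ℚ | ∃ x ∈ C, ∃ y ∈ C, x ≠ y ∧ (hammingDist x y : ℚ) = r} δ

/-- The table `T` of rows (weight, frequency) is the complete weight distribution of `C`:
the weights in the table are pairwise distinct, every row `(w, f)` says that exactly `f`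
codewords have weight `w`, and every codeword has a weight that is listed. -/
def HasWeightDistribution {K : Type*} [Field K] [DecidableEq K] {n : ℕ}
    (C : Submodule K (Fin n → K)) (T : List (ℚ × ℚ)) : Prop :=
  (T.map Prod.fst).Nodup ∧
  (∀ r ∈ T, ∃ w : ℕ, (w : ℚ) = r.1 ∧ (weightCount C w : ℚ) = r.2) ∧
  (∀ c ∈ C, (hammingNorm c : ℚ) ∈ T.map Prod.fst)

/-- `ε = 0` if `(m/2) / gcd(m,e)` is odd, and `ε = gcd(m,e)` if it is even. -/
def epsilon (m e : ℕ) : ℕ :=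
  if Odd (m / 2 / Nat.gcd m e) then 0 else Nat.gcd m e

/-! ### Character sums of balanced quadratic forms -/

section QuadraticCounting

open Finset Module

/-! Put `Q x = Tr(x^(q^e+1))`, a quadratic form on `L` over `K` with polar form `B`. For `u = 1/2`
one has `Tr x = B(u, x)` and `Q u = m/4`, so the two cases of the theorem are `u` anisotropic and
`u` isotropic. The trace form is nondegenerate, so the codewords are the evaluations of all
functionals `g`; with `f = Tr`, the weight of `g` is the number of `x` with `Q x = 0` or `f x = 0`,
but `g x ≠ 0` (`unionWeight`). Inclusion-exclusion reduces it to counting zeros of `Q` on subspaces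
of codimension at most 2.

Every `c ≠ 0` in `K` is some `z^(q^e+1)`, and then `Q (z x) = c Q x`: the nonzero values of `Q` are
equally frequent (`isBalanced_powerTraceForm`). Hence the sum of `ψ(a Q x)` over `x` is one rational
number `G` for all `a ≠ 0`. Completing the square, the sum of `ψ(a Q x + g x)` over `x` and `a ≠ 0`
is `G (q [Q c = 0] - 1)` if `g = B(c, ·)`, and 0 if `g` is not of this form
(`sum_addChar_balanced_add_dual`). The weight of a represented `g` independent of `f` therefore
depends only on the zeros of `Q` on the span of `u` and `c`: on `Q c`, `B(u, c)` and the quadratic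
character of `B(u, c)^2 - 4 Q u Q c`. This sorts the functionals into seven or five classes, zero
included. Class sizes are counted on vectors and divided by the size of the radical; the last one
follows by subtraction.

Finally `G^2 = |rad| q^m`, where the radical, given by `r^(q^(2e)) = -r`, has `q^(2ε)` elements. The
sign is negative: with `g = gcd(m, e)`, multiplication by `(q^g+1)`-th roots of unity shows that
`q^g + 1` divides the number of `x` with `Q x = 1`, whereas `G = q^(ℓ+ε)` would make it divide 2
(`gaussValue_powerTraceForm`). -/

theorem ncard_setOf_eq_sum {α R : Type*} [Fintype α] [Semiring R] (P : α → Prop)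
    [DecidablePred P] : ((Set.ncard {x | P x} : ℕ) : R) = ∑ x, if P x then 1 else 0 := by
  rw [Set.ncard_eq_toFinset_card', Finset.sum_boole]
  simp

theorem ncard_inter_add_ncard_diff {α : Type*} [Finite α] (P S : α → Prop) :
    Set.ncard {x | P x ∧ S x} + Set.ncard {x | P x ∧ ¬ S x} = Set.ncard {x | P x} := by
  have := Set.ncard_inter_add_ncard_sdiff_eq_ncard {x | P x} {x | S x}
  exact this

variable {K V : Type*} [Field K] [AddCommGroup V] [Module K V]

theorem polarBilin_self (Q : QuadraticForm K V) (x : V) : Q.polarBilin x x = 2 * Q x := by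
  simp [QuadraticMap.polar_self]

theorem polarBilin_comm (Q : QuadraticForm K V) (x y : V) :
    Q.polarBilin x y = Q.polarBilin y x := by
  simp [QuadraticMap.polar_comm]

theorem map_add_eq (Q : QuadraticForm K V) (x y : V) :
    Q (x + y) = Q x + Q y + Q.polarBilin x y := by
  simp [QuadraticMap.polar]

theorem eq_of_polarBilin_eq (h2 : (2 : K) ≠ 0) (Q : QuadraticForm K V) {c d : V}
    (h : Q.polarBilin c = Q.polarBilin d) : Q c = Q d := by
  have h1 : Q.polarBilin c c = Q.polarBilin d d := by
    rw [h, polarBilin_comm, h]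
  rw [polarBilin_self, polarBilin_self] at h1
  exact mul_left_cancel₀ h2 h1

theorem eq_zero_of_polarBilin_eq_zero (h2 : (2 : K) ≠ 0) (Q : QuadraticForm K V) {c : V}
    (h : Q.polarBilin c = 0) : Q c = 0 := by
  rw [eq_of_polarBilin_eq h2 Q (c := c) (d := 0) (by rw [h, map_zero]), map_zero]

/-- A functional that vanishes on the radical is represented by a vector. -/
theorem exists_polarBilin_eq [FiniteDimensional K V] (Q : QuadraticForm K V) (f : Dual K V)
    (h : ∀ r, Q.polarBilin r = 0 → f r = 0) : ∃ c, Q.polarBilin c = f := by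
  have hle : LinearMap.range Q.polarBilin ≤
      (LinearMap.ker Q.polarBilin).dualAnnihilator := by
    rintro _ ⟨c, rfl⟩
    rw [Submodule.mem_dualAnnihilator]
    intro w hw
    rw [polarBilin_comm, LinearMap.mem_ker.1 hw]
    rfl
  -- Symmetry of the polar form puts its range inside the annihilator of the radical; rank-nullity
  -- makes the dimensions agree.
  have heq := Submodule.eq_of_le_of_finrank_eq hle (by
    have h1 := LinearMap.finrank_range_add_finrank_ker Q.polarBilin
    have h2 := Subspace.finrank_add_finrank_dualAnnihilator_eq (LinearMap.ker Q.polarBilin)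
    linarith)
  have : f ∈ (LinearMap.ker Q.polarBilin).dualAnnihilator := by
    rw [Submodule.mem_dualAnnihilator]
    exact fun w hw => h w hw
  rw [← heq] at this
  exact this

theorem sum_addChar_dual {ψ : AddChar K ℂ} (hψ : ψ.IsPrimitive) {Y : Type*} [AddCommGroup Y]
    [Module K Y] [Fintype Y] (f : Dual K Y) [Decidable (f = 0)] :
    ∑ y, ψ (f y) = if f = 0 then (Fintype.card Y : ℂ) else 0 := by
  classical
  have h := AddChar.sum_eq_ite (ψ.compAddMonoidHom f.toAddMonoidHom)
  have h0 : ψ.compAddMonoidHom f.toAddMonoidHom = 0 ↔ f = 0 := by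
    constructor
    · intro h1
      by_contra hf
      obtain ⟨y, hy⟩ : ∃ y, f y ≠ 0 := by
        by_contra! h2
        exact hf (LinearMap.ext h2)
      -- A nonzero `f` is onto `K`, so triviality of `ψ ∘ f` would make `ψ` trivial.
      refine hψ (one_ne_zero) ?_
      ext t
      have := DFunLike.congr_fun h1 ((t / f y) • y)
      simpa [hy] using this
    · rintro rfl
      ext y
      simp
  rw [show (∑ y, ψ (f y)) = ∑ y, (ψ.compAddMonoidHom f.toAddMonoidHom) y from rfl, h]
  simp only [h0]

variable [Fintype K] [Fintype V]

theorem sum_addChar_mul {ψ : AddChar K ℂ} (hψ : ψ.IsPrimitive) [DecidableEq K] (b : K) :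
    ∑ a, ψ (a * b) = if b = 0 then (Fintype.card K : ℂ) else 0 := by
  rw [AddChar.sum_mulShift b hψ]
  split_ifs <;> simp

/-- The values of `Q` are balanced if all nonzero values are taken equally often. -/
def IsBalanced (Q : QuadraticForm K V) : Prop :=
  ∀ c, c ≠ 0 → Set.ncard {x | Q x = c} = Set.ncard {x | Q x = 1}

/-- The common value of the quadratic Gauss sums of a balanced form. -/
noncomputable def gaussValue (Q : QuadraticForm K V) : ℚ :=
  (Set.ncard {x | Q x = 0} : ℚ) - Set.ncard {x | Q x = 1}

/-- Group the `x` by the value of `Q`. The part of the multiplicity common to all values cancels by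
orthogonality, leaving the excess of zeros over ones. -/
theorem sum_addChar_balanced {ψ : AddChar K ℂ} (hψ : ψ.IsPrimitive) {Q : QuadraticForm K V}
    (hQ : IsBalanced Q) {a : K} (ha : a ≠ 0) :
    ∑ x, ψ (a * Q x) = (gaussValue Q : ℂ) := by
  classical
  have h1 : ∑ x, ψ (a * Q x) = ∑ c, (Set.ncard {x | Q x = c} : ℂ) * ψ (a * c) := by
    simp_rw [ncard_setOf_eq_sum, Finset.sum_mul]
    rw [Finset.sum_comm]
    simp only [ite_mul, one_mul, zero_mul, Finset.sum_ite_eq, Finset.mem_univ, if_true]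
  have h2 : ∀ c, (Set.ncard {x | Q x = c} : ℂ) =
      Set.ncard {x | Q x = 1} + if c = 0 then (gaussValue Q : ℂ) else 0 := by
    intro c
    split_ifs with hc
    · rw [hc, gaussValue]
      push_cast
      ring
    · rw [hQ c hc, add_zero]
  rw [h1, Finset.sum_congr rfl fun c _ => by rw [h2 c, add_mul]]
  simp_rw [Finset.sum_add_distrib, ← Finset.mul_sum]
  have h3 := sum_addChar_mul hψ a
  simp_rw [mul_comm _ a] at h3
  rw [h3]
  simp [ha]

open Classical in
/-- For a represented functional `f = B(c, ·)`, the value `|K| [Q c = 0] - 1`;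
zero if `f` is not represented. -/
noncomputable def dualSign (Q : QuadraticForm K V) (f : Dual K V) : ℚ :=
  if h : ∃ c, Q.polarBilin c = f then
    (if Q h.choose = 0 then (Fintype.card K : ℚ) else 0) - 1 else 0

open Classical in
theorem dualSign_polarBilin (h2 : (2 : K) ≠ 0) (Q : QuadraticForm K V) (c : V) :
    dualSign Q (Q.polarBilin c) = (if Q c = 0 then (Fintype.card K : ℚ) else 0) - 1 := by
  have h : ∃ d, Q.polarBilin d = Q.polarBilin c := ⟨c, rfl⟩
  rw [dualSign, dif_pos h, eq_of_polarBilin_eq h2 Q h.choose_spec]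

open Classical in
theorem sum_addChar_balanced_add_dual {ψ : AddChar K ℂ} (hψ : ψ.IsPrimitive)
    (h2 : (2 : K) ≠ 0) {Q : QuadraticForm K V} (hQ : IsBalanced Q) (f : Dual K V) :
    ∑ a ∈ univ.erase (0 : K), ∑ x, ψ (a * Q x + f x) =
      (gaussValue Q : ℂ) * (dualSign Q f : ℂ) := by
  by_cases hf : ∃ c, Q.polarBilin c = f
  · obtain ⟨c, rfl⟩ := hf
    rw [dualSign_polarBilin h2]
    -- Translating `x` by `-c/a` turns `a Q x + B(c, x)` into `a Q x - Q c / a`.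
    have h1 : ∀ a ∈ univ.erase (0 : K), ∑ x, ψ (a * Q x + Q.polarBilin c x) =
        ψ (-Q c * a⁻¹) * gaussValue Q := by
      intro a ha
      have ha : a ≠ 0 := by simpa using ha
      rw [← sum_addChar_balanced hψ hQ ha, Finset.mul_sum,
        ← Equiv.sum_comp (Equiv.addRight (-(a⁻¹ • c)))]
      refine Finset.sum_congr rfl fun x _ => ?_
      rw [← AddChar.map_add_eq_mul]
      congr 1
      simp only [Equiv.coe_addRight, map_add_eq, map_add, map_neg, map_smul, QuadraticMap.map_neg,
        QuadraticMap.map_smul, polarBilin_self, smul_eq_mul, polarBilin_comm Q c x]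
      field_simp
      ring
    rw [Finset.sum_congr rfl h1, ← Finset.sum_mul, mul_comm]
    congr 1
    have h3 := sum_addChar_mul hψ (-Q c)
    rw [← Finset.add_sum_erase _ _ (mem_univ (0 : K))] at h3
    have h4 : ∑ a ∈ univ.erase (0 : K), ψ (-Q c * a⁻¹) = ∑ a ∈ univ.erase (0 : K), ψ (a * -Q c) := by
      refine Finset.sum_bij' (fun a _ => a⁻¹) (fun a _ => a⁻¹) ?_ ?_ ?_ ?_ ?_ <;>
        simp +contextual [mul_comm]
    rw [h4]
    simp only [zero_mul, AddChar.map_zero_eq_one, neg_eq_zero] at h3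
    push_cast
    rw [eq_sub_iff_add_eq, add_comm, h3]
    split_ifs <;> simp
  · rw [dualSign, dif_neg hf]
    simp only [Rat.cast_zero, mul_zero]
    refine Finset.sum_eq_zero fun a _ => ?_
    -- An unrepresented `f` is nonzero somewhere on the radical. Translation along the radical fixes
    -- `Q` but multiplies the sum by `ψ t ≠ 1`, so the sum vanishes.
    obtain ⟨r, hr, hfr⟩ : ∃ r, Q.polarBilin r = 0 ∧ f r ≠ 0 := by
      by_contra! h
      exact hf (exists_polarBilin_eq Q f h)
    obtain ⟨t, ht⟩ : ∃ t, ψ t ≠ 1 := by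
      have := hψ one_ne_zero
      rw [AddChar.mulShift_one] at this
      exact AddChar.ne_one_iff.1 this
    set s := (t / f r) • r
    have hs : Q.polarBilin s = 0 := by simp only [s, map_smul, hr, smul_zero]
    have hfs : f s = t := by simp [s, hfr]
    have hsum : ∑ x, ψ (a * Q x + f x) = ψ t * ∑ x, ψ (a * Q x + f x) := by
      rw [Finset.mul_sum]
      nth_rw 1 [← Equiv.sum_comp (Equiv.addRight s)]
      refine Finset.sum_congr rfl fun x _ => ?_
      rw [← AddChar.map_add_eq_mul]
      congr 1
      have hx : Q.polarBilin x s = 0 := by rw [polarBilin_comm, hs]; rfl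
      simp only [Equiv.coe_addRight, map_add_eq, map_add, hx, hfs,
        eq_zero_of_polarBilin_eq_zero h2 Q hs]
      ring
    have : (1 - ψ t) * ∑ x, ψ (a * Q x + f x) = 0 := by
      rw [sub_mul, one_mul, ← hsum, sub_self]
    rcases mul_eq_zero.1 this with h | h
    · exact absurd (sub_eq_zero.1 h).symm ht
    · exact h

/-- The number of zeros of a balanced form on the subspace cut out by a family of functionals. -/
theorem card_mul_ncard_zeros (h2 : (2 : K) ≠ 0) {Q : QuadraticForm K V} (hQ : IsBalanced Q)
    {Y : Type*} [AddCommGroup Y] [Module K Y] [Fintype Y] (F : Y →ₗ[K] Dual K V) :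
    (Fintype.card K : ℚ) * Fintype.card Y * Set.ncard {x | Q x = 0 ∧ F.flip x = 0} =
      Fintype.card Y * Set.ncard {x | F.flip x = 0} + gaussValue Q * ∑ y, dualSign Q (F y) := by
  classical
  set ψ := AddChar.FiniteField.primitiveChar_to_Complex K
  have hψ : ψ.IsPrimitive := AddChar.FiniteField.primitiveChar_to_Complex_isPrimitive K
  suffices h : (Fintype.card K : ℂ) * Fintype.card Y * Set.ncard {x | Q x = 0 ∧ F.flip x = 0} =
      Fintype.card Y * Set.ncard {x | F.flip x = 0} +
        (gaussValue Q : ℂ) * ∑ y, (dualSign Q (F y) : ℂ) by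
    exact_mod_cast h
  -- Summing over `a` detects `Q x = 0`, summing over `y` detects that every `F y` vanishes at `x`.
  -- The term `a = 0` then gives the main term, the others the multiple of the Gauss value.
  have hS1 : ∑ x, ∑ a : K, ∑ y, ψ (a * Q x + F y x) =
      (Fintype.card K : ℂ) * Fintype.card Y * Set.ncard {x | Q x = 0 ∧ F.flip x = 0} := by
    rw [ncard_setOf_eq_sum, Finset.mul_sum]
    refine Finset.sum_congr rfl fun x _ => ?_
    simp_rw [AddChar.map_add_eq_mul, ← Finset.mul_sum, ← Finset.sum_mul]
    rw [sum_addChar_mul hψ, show (∑ y, ψ (F y x)) = ∑ y, ψ (F.flip x y) from rfl,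
      sum_addChar_dual hψ]
    by_cases h1 : Q x = 0 <;> by_cases h2 : F.flip x = 0 <;> simp [h1, h2]
  rw [← hS1]
  have hS2 : ∑ x, ∑ a : K, ∑ y, ψ (a * Q x + F y x) =
      ∑ a : K, ∑ x, ∑ y, ψ (a * Q x + F y x) := Finset.sum_comm
  rw [hS2, ← Finset.add_sum_erase _ _ (mem_univ (0 : K))]
  congr 1
  · rw [ncard_setOf_eq_sum, Finset.mul_sum]
    refine Finset.sum_congr rfl fun x _ => ?_
    simp only [zero_mul, zero_add]
    rw [show (∑ y, ψ (F y x)) = ∑ y, ψ (F.flip x y) from rfl, sum_addChar_dual hψ]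
    simp
  · rw [Finset.mul_sum]
    simp_rw [← sum_addChar_balanced_add_dual hψ h2 hQ]
    conv_rhs => rw [Finset.sum_comm]
    exact Finset.sum_congr rfl fun a _ => Finset.sum_comm

end QuadraticCounting

/-! ### Zero counts on lines and planes, and the weight formula -/

section QuadraticWeights

open Finset Module

theorem ncard_roots_quadratic {K : Type*} [Field K] [Fintype K] [DecidableEq K]
    (h2 : (2 : K) ≠ 0) {a : K} (ha : a ≠ 0) (b c : K) :
    (Set.ncard {y : K | a * y ^ 2 + b * y + c = 0} : ℤ) =
      quadraticChar K (b ^ 2 - 4 * a * c) + 1 := by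
  have hchar : ringChar K ≠ 2 := by
    intro h
    apply h2
    have := ringChar.Nat.cast_ringChar (R := K)
    rw [h] at this
    exact_mod_cast this
  have h2a : 2 * a ≠ 0 := mul_ne_zero h2 ha
  rw [← quadraticChar_card_sqrts hchar, ← Set.ncard_eq_toFinset_card']
  congr 1
  refine Set.ncard_congr (fun y _ => 2 * a * y + b) ?_ ?_ ?_
  · intro y hy
    simp only [Set.mem_ofPred_eq] at hy ⊢
    linear_combination (4 * a) * hy
  · intro x y _ _ h
    exact mul_left_cancel₀ h2a (add_right_cancel h)
  · intro s hs
    refine ⟨(s - b) / (2 * a), ?_, by field_simp; ring⟩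
    simp only [Set.mem_ofPred_eq] at hs ⊢
    field_simp
    linear_combination hs

theorem ncard_prod_eq_sum {α β : Type*} [Fintype α] [Fintype β] (P : α → β → Prop) :
    Set.ncard {x : α × β | P x.1 x.2} = ∑ b, Set.ncard {a | P a b} := by
  classical
  have h : ∀ b, Set.ncard {a | P a b} = ∑ a, if P a b then 1 else 0 := fun b => by
    simpa using ncard_setOf_eq_sum (R := ℕ) (fun a => P a b)
  have h' := ncard_setOf_eq_sum (R := ℕ) (fun x : α × β => P x.1 x.2)
  simp_rw [h]
  rw [Nat.cast_id] at h'
  rw [h', Fintype.sum_prod_type, Finset.sum_comm]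

/-- Fix `z = x.2`. For `z ≠ 0` the quadratic in `x.1` has discriminant a nonzero square times `b^2 -
4ac`; for `z = 0` its only root is 0. -/
theorem ncard_zeros_binary {K : Type*} [Field K] [Fintype K] [DecidableEq K]
    (h2 : (2 : K) ≠ 0) {a : K} (ha : a ≠ 0) (b c : K) :
    (Set.ncard {x : K × K | a * x.1 ^ 2 + b * x.1 * x.2 + c * x.2 ^ 2 = 0} : ℚ) =
      Fintype.card K + (Fintype.card K - 1) * (quadraticChar K (b ^ 2 - 4 * a * c) : ℤ) := by
  have hsum := ncard_prod_eq_sum (fun y z : K => a * y ^ 2 + b * y * z + c * z ^ 2 = 0)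
  have hterm : ∀ z : K, (Set.ncard {y : K | a * y ^ 2 + b * y * z + c * z ^ 2 = 0} : ℚ) =
      (if z = 0 then 0 else ((quadraticChar K (b ^ 2 - 4 * a * c) : ℤ) : ℚ)) + 1 := by
    intro z
    have h := ncard_roots_quadratic h2 ha (b * z) (c * z ^ 2)
    have hset : {y : K | a * y ^ 2 + b * y * z + c * z ^ 2 = 0} =
        {y : K | a * y ^ 2 + b * z * y + c * z ^ 2 = 0} := by
      ext y
      simp only [Set.mem_ofPred_eq]
      rw [show b * y * z = b * z * y by ring]
    rw [hset]
    have hd : (b * z) ^ 2 - 4 * a * (c * z ^ 2) = (b ^ 2 - 4 * a * c) * z ^ 2 := by ring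
    rw [hd, map_mul] at h
    split_ifs with hz
    · rw [hz] at h ⊢
      simp only [ne_eq, OfNat.ofNat_ne_zero, not_false_eq_true, zero_pow,
        MulChar.map_zero, mul_zero] at h
      have h' : ((Set.ncard {y : K | a * y ^ 2 + b * 0 * y + c * 0 ^ 2 = 0} : ℤ) : ℚ) = 1 := by
        simp only [ne_eq, OfNat.ofNat_ne_zero, not_false_eq_true, zero_pow, mul_zero]
        rw [h]
        norm_num
      simpa using h'
    · rw [quadraticChar_sq_one' hz, mul_one] at h
      exact_mod_cast h
  rw [hsum]
  push_cast
  simp_rw [hterm]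
  rw [Finset.sum_add_distrib, ← Finset.add_sum_erase _ _ (Finset.mem_univ (0 : K)),
    Finset.sum_congr rfl (g := fun _ => ((quadraticChar K (b ^ 2 - 4 * a * c) : ℤ) : ℚ))
      (fun z hz => if_neg (Finset.ne_of_mem_erase hz))]
  have hpos : 1 ≤ Fintype.card K := Fintype.card_pos
  simp only [if_true, Finset.sum_const, Finset.card_erase_of_mem (Finset.mem_univ _),
    Finset.card_univ, nsmul_eq_mul, Nat.cast_sub hpos]
  push_cast
  ring

variable {K V : Type*} [Field K] [Fintype K] [AddCommGroup V] [Module K V] [Fintype V]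

theorem card_mul_ncard_ker {Y : Type*} [AddCommGroup Y] [Module K Y] [Fintype Y]
    {F : Y →ₗ[K] Dual K V} (hF : Function.Injective F) :
    (Fintype.card Y : ℚ) * Set.ncard {x | F.flip x = 0} = Fintype.card V := by
  classical
  set ψ := AddChar.FiniteField.primitiveChar_to_Complex K
  have hψ : ψ.IsPrimitive := AddChar.FiniteField.primitiveChar_to_Complex_isPrimitive K
  suffices h : (Fintype.card Y : ℂ) * Set.ncard {x | F.flip x = 0} = Fintype.card V by
    exact_mod_cast h
  have h1 : ∑ x, ∑ y, ψ (F y x) = (Fintype.card Y : ℂ) * Set.ncard {x | F.flip x = 0} := by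
    rw [ncard_setOf_eq_sum, Finset.mul_sum]
    refine Finset.sum_congr rfl fun x _ => ?_
    rw [show (∑ y, ψ (F y x)) = ∑ y, ψ (F.flip x y) from rfl, sum_addChar_dual hψ]
    simp
  rw [← h1, Finset.sum_comm]
  simp_rw [sum_addChar_dual hψ, map_eq_zero_iff F hF]
  simp

theorem card_mul_ncard_zeros_of_injective (h2 : (2 : K) ≠ 0) {Q : QuadraticForm K V}
    (hQ : IsBalanced Q) {Y : Type*} [AddCommGroup Y] [Module K Y] [Fintype Y]
    {F : Y →ₗ[K] Dual K V} (hF : Function.Injective F) :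
    (Fintype.card K : ℚ) * Fintype.card Y * Set.ncard {x | Q x = 0 ∧ F.flip x = 0} =
      Fintype.card V + gaussValue Q * ∑ y, dualSign Q (F y) := by
  rw [card_mul_ncard_zeros h2 hQ, card_mul_ncard_ker hF]

/-- Multiply the sums for `a = 1` and `a = -1` and substitute `x = y + z`: the exponent becomes `Q z
+ B(z, y)`. Summing over `y` keeps only the `z` in the radical, where `Q` vanishes. -/
theorem gaussValue_sq (h2 : (2 : K) ≠ 0) {Q : QuadraticForm K V} (hQ : IsBalanced Q) :
    gaussValue Q ^ 2 = Set.ncard {r | Q.polarBilin r = 0} * Fintype.card V := by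
  classical
  set ψ := AddChar.FiniteField.primitiveChar_to_Complex K
  have hψ : ψ.IsPrimitive := AddChar.FiniteField.primitiveChar_to_Complex_isPrimitive K
  suffices h : (gaussValue Q : ℂ) ^ 2 = Set.ncard {r | Q.polarBilin r = 0} * Fintype.card V by
    exact_mod_cast h
  have h1 := sum_addChar_balanced hψ hQ (one_ne_zero (α := K))
  have h2' := sum_addChar_balanced hψ hQ (neg_ne_zero.2 (one_ne_zero (α := K)))
  rw [sq]
  nth_rw 1 [← h1]
  rw [← h2', Finset.sum_mul_sum, Finset.sum_comm]
  have h3 : ∀ y, ∑ x, ψ (1 * Q x) * ψ (-1 * Q y) = ∑ z, ψ (Q z) * ψ (Q.polarBilin z y) := by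
    intro y
    rw [← Equiv.sum_comp (Equiv.addRight y)]
    refine Finset.sum_congr rfl fun z _ => ?_
    rw [← AddChar.map_add_eq_mul, ← AddChar.map_add_eq_mul]
    congr 1
    simp only [Equiv.coe_addRight, map_add_eq]
    ring
  simp_rw [h3]
  rw [Finset.sum_comm, ncard_setOf_eq_sum, Finset.sum_mul]
  refine Finset.sum_congr rfl fun z _ => ?_
  rw [← Finset.mul_sum, sum_addChar_dual hψ]
  split_ifs with h
  · rw [eq_zero_of_polarBilin_eq_zero h2 Q h]
    simp
  · simp

theorem ncard_zeros_add (Q : QuadraticForm K V) (hQ : IsBalanced Q) :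
    (Set.ncard {x | Q x = 0} : ℚ) + (Fintype.card K - 1) * Set.ncard {x | Q x = 1} =
      Fintype.card V := by
  classical
  have h1 : (Fintype.card V : ℚ) = ∑ c, (Set.ncard {x | Q x = c} : ℚ) := by
    simp_rw [ncard_setOf_eq_sum]
    rw [Finset.sum_comm]
    simp
  rw [h1, ← Finset.add_sum_erase _ _ (mem_univ (0 : K)),
    Finset.sum_congr rfl (g := fun _ => (Set.ncard {x | Q x = 1} : ℚ))
      fun c hc => by rw [hQ c (Finset.ne_of_mem_erase hc)]]
  have hpos : 1 ≤ Fintype.card K := Fintype.card_pos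
  simp [Nat.cast_sub hpos]

theorem card_mul_ncard_zeros_univ {Q : QuadraticForm K V} (hQ : IsBalanced Q) :
    (Fintype.card K : ℚ) * Set.ncard {x | Q x = 0} =
      Fintype.card V + gaussValue Q * (Fintype.card K - 1) := by
  have h := ncard_zeros_add Q hQ
  rw [gaussValue]
  linear_combination h

theorem card_mul_ncard_ones {Q : QuadraticForm K V} (hQ : IsBalanced Q) :
    (Fintype.card K : ℚ) * Set.ncard {x | Q x = 1} = Fintype.card V - gaussValue Q := by
  have h := ncard_zeros_add Q hQ
  rw [gaussValue]
  linear_combination h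

/-- Sum of `dualSign` over the line spanned by `f`. -/
noncomputable def lineSign (Q : QuadraticForm K V) (f : Dual K V) : ℚ :=
  ∑ y : K, dualSign Q (y • f)

/-- Sum of `dualSign` over the plane spanned by `f` and `g`. -/
noncomputable def planeSign (Q : QuadraticForm K V) (f g : Dual K V) : ℚ :=
  ∑ y : K × K, dualSign Q (y.1 • f + y.2 • g)

theorem card_mul_ncard_dual_eq_zero {f : Dual K V} (hf : f ≠ 0) :
    (Fintype.card K : ℚ) * Set.ncard {x | f x = 0} = Fintype.card V := by
  have h := card_mul_ncard_ker (F := LinearMap.toSpanSingleton K (Dual K V) f)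
    (fun a b hab => smul_left_injective K hf (by simpa using hab))
  rw [← h]
  congr 3
  ext x
  simp only [Set.mem_ofPred_eq, LinearMap.ext_iff]
  constructor
  · intro h y
    simp [h]
  · intro h
    simpa using h 1

theorem card_mul_ncard_zeros_dual (h2 : (2 : K) ≠ 0) {Q : QuadraticForm K V}
    (hQ : IsBalanced Q) {f : Dual K V} (hf : f ≠ 0) :
    (Fintype.card K : ℚ) ^ 2 * Set.ncard {x | Q x = 0 ∧ f x = 0} =
      Fintype.card V + gaussValue Q * lineSign Q f := by
  have h := card_mul_ncard_zeros_of_injective h2 hQ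
    (F := LinearMap.toSpanSingleton K (Dual K V) f)
    (fun a b hab => smul_left_injective K hf (by simpa using hab))
  rw [lineSign]
  simp only [LinearMap.toSpanSingleton_apply] at h
  rw [← h, sq]
  congr 3
  ext x
  simp only [Set.mem_ofPred_eq, LinearMap.ext_iff]
  refine and_congr_right fun _ => ⟨fun h y => by simp [h], fun h => by simpa using h 1⟩

omit [Fintype K] [Fintype V] in
-- The two hypotheses say that `f` and `g` are linearly independent, so the plane of functionals is
-- parametrized without repetition.
theorem coprod_toSpanSingleton_injective {f g : Dual K V} (hf : f ≠ 0) (hg : ∀ t : K, g ≠ t • f) :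
    Function.Injective ((LinearMap.toSpanSingleton K (Dual K V) f).coprod
      (LinearMap.toSpanSingleton K (Dual K V) g)) := by
  rw [← LinearMap.ker_eq_bot, LinearMap.ker_eq_bot']
  rintro ⟨y, z⟩ h
  simp only [LinearMap.coprod_apply, LinearMap.toSpanSingleton_apply] at h
  have hz : z = 0 := by
    by_contra hz
    apply hg (-(z⁻¹ * y))
    have h' := congrArg (fun k => z⁻¹ • k) h
    simp only [smul_add, inv_smul_smul₀ hz, smul_zero, ← mul_smul] at h'
    exact (eq_neg_of_add_eq_zero_right h').trans (neg_smul (z⁻¹ * y) f).symm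
  subst hz
  have hy : y = 0 := by simpa [hf] using h
  rw [hy]
  rfl

theorem card_mul_ncard_dual_dual_eq_zero {f g : Dual K V} (hf : f ≠ 0)
    (hg : ∀ t : K, g ≠ t • f) :
    (Fintype.card K : ℚ) ^ 2 * Set.ncard {x | f x = 0 ∧ g x = 0} = Fintype.card V := by
  have h := card_mul_ncard_ker (coprod_toSpanSingleton_injective hf hg)
  rw [← h, Fintype.card_prod, Nat.cast_mul, ← sq]
  congr 3
  ext x
  simp only [Set.mem_ofPred_eq, LinearMap.ext_iff]
  refine ⟨fun h y => by simp [h], fun h => ⟨by simpa using h (1, 0), by simpa using h (0, 1)⟩⟩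

theorem card_mul_ncard_zeros_dual_dual (h2 : (2 : K) ≠ 0) {Q : QuadraticForm K V}
    (hQ : IsBalanced Q) {f g : Dual K V} (hf : f ≠ 0) (hg : ∀ t : K, g ≠ t • f) :
    (Fintype.card K : ℚ) ^ 3 * Set.ncard {x | Q x = 0 ∧ f x = 0 ∧ g x = 0} =
      Fintype.card V + gaussValue Q * planeSign Q f g := by
  have h := card_mul_ncard_zeros_of_injective h2 hQ (coprod_toSpanSingleton_injective hf hg)
  rw [planeSign]
  simp only [LinearMap.coprod_apply, LinearMap.toSpanSingleton_apply] at h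
  rw [← h, Fintype.card_prod, Nat.cast_mul, show ∀ a : ℚ, a ^ 3 = a * (a * a) by intro a; ring]
  congr 3
  ext x
  simp only [Set.mem_ofPred_eq, LinearMap.ext_iff]
  refine and_congr_right fun _ => ⟨fun h y => by simp [h],
    fun h => ⟨by simpa using h (1, 0), by simpa using h (0, 1)⟩⟩

/-- The number of `x` with `Q x = 0` or `f x = 0` at which the functional `g` does not vanish. -/
noncomputable def unionWeight (Q : QuadraticForm K V) (f g : Dual K V) : ℕ :=
  Set.ncard {x | (Q x = 0 ∨ f x = 0) ∧ g x ≠ 0}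

omit [Fintype K] in
theorem unionWeight_eq (Q : QuadraticForm K V) (f g : Dual K V) :
    (unionWeight Q f g : ℚ) = Set.ncard {x | Q x = 0} - Set.ncard {x | Q x = 0 ∧ g x = 0}
      + Set.ncard {x | f x = 0} - Set.ncard {x | f x = 0 ∧ g x = 0}
      - Set.ncard {x | Q x = 0 ∧ f x = 0} + Set.ncard {x | Q x = 0 ∧ f x = 0 ∧ g x = 0} := by
  classical
  rw [unionWeight]
  simp_rw [ncard_setOf_eq_sum, ← Finset.sum_sub_distrib, ← Finset.sum_add_distrib,
    ← Finset.sum_sub_distrib, ← Finset.sum_add_distrib]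
  refine Finset.sum_congr rfl fun x _ => ?_
  by_cases h1 : Q x = 0 <;> by_cases h2 : f x = 0 <;> by_cases h3 : g x = 0 <;> simp [h1, h2, h3]

/-- In the inclusion-exclusion formula, for fixed `f`, only the two sign sums involving `g` vary, so
they alone separate the weights. -/
theorem unionWeight_of_independent (h2 : (2 : K) ≠ 0) {Q : QuadraticForm K V}
    (hQ : IsBalanced Q) {f g : Dual K V} (hf : f ≠ 0) (hg : ∀ t : K, g ≠ t • f) :
    (Fintype.card K : ℚ) ^ 3 * unionWeight Q f g =
      Fintype.card V * (Fintype.card K - 1) * (2 * Fintype.card K - 1) +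
      gaussValue Q * ((Fintype.card K : ℚ) ^ 2 * (Fintype.card K - 1)
        - Fintype.card K * lineSign Q g - Fintype.card K * lineSign Q f + planeSign Q f g) := by
  have hg0 : g ≠ 0 := by simpa using hg 0
  rw [unionWeight_eq]
  linear_combination (Fintype.card K : ℚ) ^ 2 * card_mul_ncard_zeros_univ hQ
    - (Fintype.card K : ℚ) * card_mul_ncard_zeros_dual h2 hQ hg0
    + (Fintype.card K : ℚ) ^ 2 * card_mul_ncard_dual_eq_zero hf
    - (Fintype.card K : ℚ) * card_mul_ncard_dual_dual_eq_zero hf hg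
    - (Fintype.card K : ℚ) * card_mul_ncard_zeros_dual h2 hQ hf
    + card_mul_ncard_zeros_dual_dual h2 hQ hf hg

/-- A nonzero multiple of `f` has the kernel of `f`, so only the zeros of `Q` off that kernel are
counted. -/
theorem unionWeight_smul (h2 : (2 : K) ≠ 0) {Q : QuadraticForm K V}
    (hQ : IsBalanced Q) {f : Dual K V} (hf : f ≠ 0) {t : K} (ht : t ≠ 0) :
    (Fintype.card K : ℚ) ^ 2 * unionWeight Q f (t • f) =
      Fintype.card V * (Fintype.card K - 1) +
      gaussValue Q * (Fintype.card K * (Fintype.card K - 1) - lineSign Q f) := by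
  rw [unionWeight_eq]
  simp only [LinearMap.smul_apply, smul_eq_mul, mul_eq_zero, ht, false_or, and_self]
  linear_combination (Fintype.card K : ℚ) * card_mul_ncard_zeros_univ hQ
    - card_mul_ncard_zeros_dual h2 hQ hf

open Classical in
theorem lineSign_polarBilin (h2 : (2 : K) ≠ 0) (Q : QuadraticForm K V) (c : V) :
    lineSign Q (Q.polarBilin c) =
      if Q c = 0 then (Fintype.card K : ℚ) * (Fintype.card K - 1) else 0 := by
  rw [lineSign]
  simp_rw [← map_smul, dualSign_polarBilin h2]
  rw [Finset.sum_sub_distrib]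
  simp only [QuadraticMap.map_smul, smul_eq_mul, mul_eq_zero]
  split_ifs with h
  · simp [h]
    ring
  · simp [h]

theorem lineSign_of_not_exists (h2 : (2 : K) ≠ 0) (Q : QuadraticForm K V) {g : Dual K V}
    (hg : ¬ ∃ c, Q.polarBilin c = g) : lineSign Q g = Fintype.card K - 1 := by
  classical
  rw [lineSign, ← Finset.add_sum_erase _ _ (mem_univ (0 : K)), Finset.sum_eq_zero, zero_smul]
  · have := dualSign_polarBilin h2 Q 0
    simpa using this
  · intro y hy
    have hy : y ≠ 0 := Finset.ne_of_mem_erase hy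
    refine dif_neg ?_
    rintro ⟨c, hc⟩
    exact hg ⟨y⁻¹ • c, by rw [map_smul, hc, inv_smul_smul₀ hy]⟩

theorem planeSign_of_not_exists (Q : QuadraticForm K V) (u : V) {g : Dual K V}
    (hg : ¬ ∃ c, Q.polarBilin c = g) :
    planeSign Q (Q.polarBilin u) g = lineSign Q (Q.polarBilin u) := by
  classical
  rw [planeSign, lineSign, Fintype.sum_prod_type]
  refine Finset.sum_congr rfl fun y _ => ?_
  rw [← Finset.add_sum_erase _ _ (mem_univ (0 : K)), Finset.sum_eq_zero]
  · simp
  · intro z hz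
    have hz : z ≠ 0 := Finset.ne_of_mem_erase hz
    refine dif_neg ?_
    rintro ⟨c, hc⟩
    refine hg ⟨z⁻¹ • (c - y • u), ?_⟩
    rw [map_smul, map_sub, hc, map_smul, add_sub_cancel_left, inv_smul_smul₀ hz]

/-- Combinations of the two functionals are represented by combinations of `u` and `c`, so the sum
counts zeros of `Q` restricted to their plane, written as a binary form. -/
theorem planeSign_polarBilin (h2 : (2 : K) ≠ 0) (Q : QuadraticForm K V) (u c : V) :
    planeSign Q (Q.polarBilin u) (Q.polarBilin c) = Fintype.card K *
      Set.ncard {x : K × K | Q u * x.1 ^ 2 + Q.polarBilin u c * x.1 * x.2 + Q c * x.2 ^ 2 = 0}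
      - (Fintype.card K : ℚ) ^ 2 := by
  classical
  rw [planeSign]
  simp_rw [← map_smul, ← map_add, dualSign_polarBilin h2]
  rw [Finset.sum_sub_distrib, ncard_setOf_eq_sum, Finset.mul_sum]
  congr 1
  · refine Finset.sum_congr rfl fun x _ => ?_
    have : Q (x.1 • u + x.2 • c) =
        Q u * x.1 ^ 2 + Q.polarBilin u c * x.1 * x.2 + Q c * x.2 ^ 2 := by
      rw [map_add_eq, QuadraticMap.map_smul, QuadraticMap.map_smul, map_smul,
        map_smul, LinearMap.smul_apply]
      simp only [smul_eq_mul]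
      ring
    rw [this]
    simp
  · simp [sq]

theorem planeSign_of_ne_zero [DecidableEq K] (h2 : (2 : K) ≠ 0) (Q : QuadraticForm K V) {u : V}
    (hu : Q u ≠ 0) (c : V) :
    planeSign Q (Q.polarBilin u) (Q.polarBilin c) = (Fintype.card K : ℚ) * (Fintype.card K - 1) *
      (quadraticChar K (Q.polarBilin u c ^ 2 - 4 * Q u * Q c) : ℤ) := by
  rw [planeSign_polarBilin h2, ncard_zeros_binary h2 hu]
  ring

open Classical in
theorem planeSign_of_eq_zero (h2 : (2 : K) ≠ 0) (Q : QuadraticForm K V) {u : V}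
    (hu : Q u = 0) (c : V) :
    planeSign Q (Q.polarBilin u) (Q.polarBilin c) =
      (if Q.polarBilin u c = 0 then
        if Q c = 0 then (Fintype.card K : ℚ) ^ 2 * (Fintype.card K - 1) else 0
      else (Fintype.card K : ℚ) * (Fintype.card K - 1) : ℚ) := by
  by_cases hc : Q c = 0
  · rw [planeSign_polarBilin h2, hu, hc]
    have hsum := ncard_prod_eq_sum (fun y z : K =>
      0 * y ^ 2 + Q.polarBilin u c * y * z + 0 * z ^ 2 = 0)
    rw [hsum]
    push_cast
    by_cases h : Q.polarBilin u c = 0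
    · rw [if_pos h, if_pos rfl, h]
      simp [Set.ncard_univ]
      ring
    · rw [if_neg h, ← Finset.add_sum_erase _ _ (mem_univ (0 : K)),
        Finset.sum_congr rfl (g := fun _ => (1 : ℚ)) fun z hz => by
          have hz : z ≠ 0 := Finset.ne_of_mem_erase hz
          rw [Nat.cast_eq_one, Set.ncard_eq_one]
          refine ⟨0, ?_⟩
          ext y
          simp only [zero_mul, zero_add, add_zero, mul_eq_zero, h, hz, false_or, or_false,
            Set.mem_ofPred_eq, Set.mem_singleton_iff]]
      have hpos : 1 ≤ Fintype.card K := Fintype.card_pos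
      simp [Set.ncard_univ, Nat.cast_sub hpos]
      ring
  · have h := planeSign_of_ne_zero h2 Q hc u
    have hswap : planeSign Q (Q.polarBilin u) (Q.polarBilin c) =
        planeSign Q (Q.polarBilin c) (Q.polarBilin u) := by
      rw [planeSign, planeSign, ← Equiv.sum_comp (Equiv.prodComm K K)]
      exact Finset.sum_congr rfl fun x _ => by rw [add_comm]; rfl
    rw [hswap, h, hu, polarBilin_comm Q c u]
    simp only [mul_zero, sub_zero, hc, if_false]
    split_ifs with hB
    · simp [hB]
    · rw [quadraticChar_sq_one' hB]
      simp

end QuadraticWeights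

/-! ### Classes of functionals and their weights -/

section WeightClasses

open Finset Module

/-- Once the weights are distinct, classes that cover everything and have the right weights are
exactly the level sets; their disjointness need not be checked separately. -/
theorem setOf_weight_eq_setOf_class {α ι : Type*} {wt : α → ℚ} {w : ι → ℚ}
    (hw : Function.Injective w) {P : ι → α → Prop} (hcover : ∀ g, ∃ i, P i g)
    (hwt : ∀ i g, P i g → wt g = w i) (i : ι) : {g | wt g = w i} = {g | P i g} := by
  ext g
  refine ⟨fun h => ?_, fun h => hwt i g h⟩
  obtain ⟨j, hj⟩ := hcover g
  have : j = i := hw ((hwt j g hj).symm.trans h)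
  exact this ▸ hj

theorem sum_ncard_weight {α ι : Type*} [Fintype α] [Fintype ι] {wt : α → ℚ} {w : ι → ℚ}
    (hw : Function.Injective w) (hcover : ∀ g, ∃ i, wt g = w i) :
    ∑ i, (Set.ncard {g | wt g = w i} : ℚ) = Fintype.card α := by
  classical
  simp_rw [ncard_setOf_eq_sum]
  rw [Finset.sum_comm, Finset.sum_congr rfl (g := fun _ => (1 : ℚ))]
  · simp
  · intro g _
    obtain ⟨i, hi⟩ := hcover g
    simp [hi, hw.eq_iff]

variable {K V : Type*} [Field K] [Fintype K] [AddCommGroup V] [Module K V] [Fintype V]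

omit [Fintype K] in
/-- Passing from vectors to represented functionals divides counts by the size of the radical. -/
theorem ncard_radical_mul_ncard_image (Q : QuadraticForm K V) {P : V → Prop}
    (hP : ∀ c r, Q.polarBilin r = 0 → P c → P (c + r)) :
    (Set.ncard {r | Q.polarBilin r = 0} : ℚ) * Set.ncard {g | ∃ c, Q.polarBilin c = g ∧ P c} =
      Set.ncard {c | P c} := by
  classical
  have himage : {g | ∃ c, Q.polarBilin c = g ∧ P c} =
      ((univ.filter P).image Q.polarBilin : Finset (Dual K V)) := by
    ext g
    simp [and_comm]
  rw [himage, Set.ncard_coe_finset, Set.ncard_eq_toFinset_card' {c | P c},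
    Set.ncard_eq_toFinset_card' {r | Q.polarBilin r = 0}]
  have hsum := Finset.card_eq_sum_card_image Q.polarBilin (univ.filter P)
  rw [Finset.sum_const_nat (m := #{r | Q.polarBilin r = 0})] at hsum
  · simp only [Set.toFinset_ofPred]
    rw [hsum]
    push_cast
    ring
  · intro g hg
    obtain ⟨c, hc, rfl⟩ := Finset.mem_image.1 hg
    simp only [Finset.mem_filter, Finset.mem_univ, true_and] at hc
    refine Finset.card_bij' (fun a _ => a - c) (fun r _ => c + r) ?_ ?_ ?_ ?_
    · intro a ha
      simp only [Finset.mem_filter, Finset.mem_univ, true_and] at ha ⊢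
      rw [map_sub, ha.2, sub_self]
    · intro r hr
      simp only [Finset.mem_filter, Finset.mem_univ, true_and] at hr ⊢
      exact ⟨hP c r hr hc, by rw [map_add, hr, add_zero]⟩
    · intro a _
      simp
    · intro r _
      simp

omit [Fintype K] [Fintype V] in
theorem polarBilin_apply_radical {Q : QuadraticForm K V} {r : V} (hr : Q.polarBilin r = 0)
    (u : V) : Q.polarBilin u r = 0 := by
  rw [polarBilin_comm, hr, LinearMap.zero_apply]

omit [Fintype K] [Fintype V] in
theorem map_add_radical (h2 : (2 : K) ≠ 0) {Q : QuadraticForm K V} {r : V}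
    (hr : Q.polarBilin r = 0) (c : V) : Q (c + r) = Q c := by
  rw [map_add_eq, eq_zero_of_polarBilin_eq_zero h2 Q hr, polarBilin_apply_radical hr, add_zero,
    add_zero]

omit [Fintype V] in
theorem ncard_nonzero_multiples {f : Dual K V} (hf : f ≠ 0) :
    (Set.ncard {g | ∃ t : K, t ≠ 0 ∧ g = t • f} : ℚ) = Fintype.card K - 1 := by
  classical
  have h : {g | ∃ t : K, t ≠ 0 ∧ g = t • f} = (fun t : K => t • f) '' {t | t ≠ 0} := by
    ext g
    simp only [Set.mem_ofPred_eq, Set.mem_image, eq_comm]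
  rw [h, Set.ncard_image_of_injective _ (smul_left_injective K hf), Set.ncard_eq_toFinset_card']
  have hpos : 1 ≤ Fintype.card K := Fintype.card_pos
  simp [Finset.filter_ne', Finset.card_erase_of_mem, Nat.cast_sub hpos]

/-- The discriminant of the restriction of `Q` to the plane spanned by `u` and `c`. -/
def planeDisc (Q : QuadraticForm K V) (u c : V) : K :=
  Q.polarBilin u c ^ 2 - 4 * Q u * Q c

omit [Fintype K] [Fintype V] in
-- The discriminant is minus the Gram determinant of `u, w` for the polar form, hence unchanged when
-- a multiple of `u` is added to `w`.
theorem planeDisc_smul_add (Q : QuadraticForm K V) (u w : V) (t : K) :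
    planeDisc Q u (t • u + w) = planeDisc Q u w := by
  simp only [planeDisc, map_add_eq, map_add, map_smul, QuadraticMap.map_smul, polarBilin_self,
    LinearMap.smul_apply, smul_eq_mul]
  ring

/-- Counting vectors by the pair (`B(u, c)`, `planeDisc Q u c`). -/
theorem ncard_setOf_polarBilin_planeDisc (h2 : (2 : K) ≠ 0) (Q : QuadraticForm K V) {u : V}
    (hu : Q u ≠ 0) (R : K → K → Prop) :
    Set.ncard {c | R (Q.polarBilin u c) (planeDisc Q u c)} =
      ∑ s, Set.ncard {w | Q.polarBilin u w = 0 ∧ R s (planeDisc Q u w)} := by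
  classical
  have h1 : Set.ncard {c | R (Q.polarBilin u c) (planeDisc Q u c)} =
      ∑ s, Set.ncard {c | Q.polarBilin u c = s ∧ R s (planeDisc Q u c)} := by
    have hc := fun P : V → Prop => ncard_setOf_eq_sum (R := ℕ) P
    simp only [Nat.cast_id] at hc
    simp_rw [hc]
    rw [Finset.sum_comm]
    refine Finset.sum_congr rfl fun c _ => ?_
    simp [ite_and]
  rw [h1]
  refine Finset.sum_congr rfl fun s _ => ?_
  -- As `B(u, u) = 2 Q u`, translation by `(s / (2 Q u)) u` carries the hyperplane `B(u, ·) = 0` to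
  -- `B(u, ·) = s` and preserves the discriminant.
  have h2u : 2 * Q u ≠ 0 := mul_ne_zero h2 hu
  symm
  refine Set.ncard_congr (fun w _ => (s / (2 * Q u)) • u + w) ?_ ?_ ?_
  · rintro w ⟨hw, hR⟩
    refine ⟨?_, by rw [planeDisc_smul_add]; exact hR⟩
    rw [map_add, hw, map_smul, polarBilin_self, smul_eq_mul, div_mul_cancel₀ _ h2u, add_zero]
  · intro a b _ _ h
    exact add_left_cancel h
  · rintro c ⟨hc, hR⟩
    refine ⟨(-(s / (2 * Q u))) • u + c, ⟨?_, by rw [planeDisc_smul_add]; exact hR⟩, ?_⟩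
    · rw [map_add, hc, map_smul, polarBilin_self, smul_eq_mul, neg_mul, div_mul_cancel₀ _ h2u,
        neg_add_cancel]
    · rw [neg_smul, add_neg_cancel_left]

theorem ncard_nonzero_sqrts [DecidableEq K] (h2 : (2 : K) ≠ 0) (d : K) :
    Set.ncard {s : K | s ≠ 0 ∧ d = s ^ 2} = if quadraticChar K d = 1 then 2 else 0 := by
  have h := ncard_roots_quadratic h2 (one_ne_zero (α := K)) 0 (-d)
  have h4 : (0 : K) ^ 2 - 4 * 1 * -d = d * 2 ^ 2 := by ring
  rw [h4, map_mul, quadraticChar_sq_one' h2, mul_one] at h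
  have hset : {y : K | 1 * y ^ 2 + 0 * y + -d = 0} = {s : K | d = s ^ 2} := by
    ext y
    simp only [Set.mem_ofPred_eq, one_mul, zero_mul, add_zero, add_neg_eq_zero]
    exact eq_comm
  rw [hset] at h
  by_cases hd : d = 0
  · have : {s : K | s ≠ 0 ∧ d = s ^ 2} = ∅ := by
      ext s
      simp only [Set.mem_ofPred_eq, Set.mem_empty_iff_false, iff_false]
      exact fun hs => hs.1 (by simpa [hd] using hs.2.symm)
    rw [this, hd]
    simp
  · have : {s : K | s ≠ 0 ∧ d = s ^ 2} = {s : K | d = s ^ 2} := by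
      ext s
      simp only [Set.mem_ofPred_eq, and_iff_right_iff_imp]
      rintro hs rfl
      exact hd (by simpa using hs)
    rw [this]
    rcases quadraticChar_dichotomy hd with h1 | h1
    · rw [h1] at h
      rw [if_pos h1]
      omega
    · rw [h1] at h
      rw [if_neg (by rw [h1]; decide)]
      omega

/-- The functionals `g` sorted by their position relative to `f = B(u, ·)`, for `Q u ≠ 0`. -/
noncomputable def anisotropicClass [DecidableEq K] (Q : QuadraticForm K V) (u : V) :
    Fin 7 → Dual K V → Prop := ![
  fun g => g = 0,
  fun g => ∃ t : K, t ≠ 0 ∧ g = t • Q.polarBilin u,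
  fun g => ∃ c, Q.polarBilin c = g ∧ (Q c = 0 ∧ Q.polarBilin u c = 0) ∧ Q.polarBilin c ≠ 0,
  fun g => ∃ c, Q.polarBilin c = g ∧ Q c = 0 ∧ Q.polarBilin u c ≠ 0,
  fun g => (∃ c, Q.polarBilin c = g ∧ Q.polarBilin u c ≠ 0 ∧ planeDisc Q u c = 0) ∧
    ¬ ∃ t : K, t ≠ 0 ∧ g = t • Q.polarBilin u,
  fun g => ∃ c, Q.polarBilin c = g ∧ quadraticChar K (planeDisc Q u c) = 1 ∧ Q c ≠ 0,
  fun g => (∀ t : K, g ≠ t • Q.polarBilin u) ∧ ((¬ ∃ c, Q.polarBilin c = g) ∨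
    ∃ c, Q.polarBilin c = g ∧ Q c ≠ 0 ∧ quadraticChar K (planeDisc Q u c) = -1)]

/-- The functionals `g` sorted by their position relative to `f = B(u, ·)`, for `Q u = 0`. -/
noncomputable def isotropicClass (Q : QuadraticForm K V) (u : V) :
    Fin 5 → Dual K V → Prop := ![
  fun g => g = 0,
  fun g => ∃ t : K, t ≠ 0 ∧ g = t • Q.polarBilin u,
  fun g => ∃ c, Q.polarBilin c = g ∧ Q c = 0 ∧ Q.polarBilin u c ≠ 0,
  fun g => ∃ c, Q.polarBilin c = g ∧ Q.polarBilin u c ≠ 0 ∧ Q c ≠ 0,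
  fun g => (∀ t : K, g ≠ t • Q.polarBilin u) ∧ ((¬ ∃ c, Q.polarBilin c = g) ∨
    ∃ c, Q.polarBilin c = g ∧ Q.polarBilin u c = 0)]

omit [Fintype V] in
theorem exists_anisotropicClass [DecidableEq K] (h2 : (2 : K) ≠ 0) (Q : QuadraticForm K V)
    {u : V} (hu : Q u ≠ 0) (g : Dual K V) : ∃ i, anisotropicClass Q u i g := by
  by_cases h0 : g = 0
  · exact ⟨0, h0⟩
  by_cases h1 : ∃ t : K, t ≠ 0 ∧ g = t • Q.polarBilin u
  · exact ⟨1, h1⟩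
  have h1' : ∀ t : K, g ≠ t • Q.polarBilin u := by
    rintro t rfl
    exact h1 ⟨t, by rintro rfl; simp at h0, rfl⟩
  by_cases hg : ∃ c, Q.polarBilin c = g
  · obtain ⟨c, rfl⟩ := hg
    by_cases hQ : Q c = 0
    · by_cases hf : Q.polarBilin u c = 0
      · exact ⟨2, c, rfl, ⟨hQ, hf⟩, h0⟩
      · exact ⟨3, c, rfl, hQ, hf⟩
    · by_cases hd : planeDisc Q u c = 0
      · refine ⟨4, ⟨c, rfl, ?_, hd⟩, h1⟩
        intro hf
        rw [planeDisc, hf] at hd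
        have h4 : (4 : K) ≠ 0 := by
          rw [show (4 : K) = 2 * 2 by norm_num]
          exact mul_ne_zero h2 h2
        simp [h4, hu, hQ] at hd
      · rcases quadraticChar_dichotomy hd with h | h
        · exact ⟨5, c, rfl, h, hQ⟩
        · exact ⟨6, h1', Or.inr ⟨c, rfl, hQ, h⟩⟩
  · exact ⟨6, h1', Or.inl hg⟩

omit [Fintype K] [Fintype V] in
theorem exists_isotropicClass (Q : QuadraticForm K V) (u : V) (g : Dual K V) :
    ∃ i, isotropicClass Q u i g := by
  by_cases h0 : g = 0
  · exact ⟨0, h0⟩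
  by_cases h1 : ∃ t : K, t ≠ 0 ∧ g = t • Q.polarBilin u
  · exact ⟨1, h1⟩
  have h1' : ∀ t : K, g ≠ t • Q.polarBilin u := by
    rintro t rfl
    exact h1 ⟨t, by rintro rfl; simp at h0, rfl⟩
  by_cases hg : ∃ c, Q.polarBilin c = g
  · obtain ⟨c, rfl⟩ := hg
    by_cases hf : Q.polarBilin u c = 0
    · exact ⟨4, h1', Or.inr ⟨c, rfl, hf⟩⟩
    · by_cases hQ : Q c = 0
      · exact ⟨2, c, rfl, hQ, hf⟩
      · exact ⟨3, c, rfl, hf, hQ⟩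
  · exact ⟨4, h1', Or.inl hg⟩

/-- Weights on the classes `anisotropicClass`, in terms of `q = |K|`, `N = |V|` and the Gauss
value `G`. -/
def anisotropicWeight (q N G : ℚ) : Fin 7 → ℚ := ![
  0,
  (q - 1) * (N / q ^ 2 + G / q),
  (q - 1) * (2 * q - 1) * N / q ^ 3,
  (q - 1) * (2 * q - 1) * N / q ^ 3 + (q - 1) * G / q ^ 2,
  (q - 1) * (2 * q - 1) * N / q ^ 3 + (q - 1) * G / q,
  (q - 1) * (2 * q - 1) * N / q ^ 3 + (q - 1) * (G / q + G / q ^ 2),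
  (q - 1) * (2 * q - 1) * N / q ^ 3 + (q - 1) * (G / q - G / q ^ 2)]

/-- Weights on the classes `isotropicClass`, in terms of `q = |K|`, `N = |V|` and the Gauss
value `G`. -/
def isotropicWeight (q N G : ℚ) : Fin 5 → ℚ := ![
  0,
  (q - 1) * N / q ^ 2,
  (q - 1) * (2 * q - 1) * N / q ^ 3 - (q - 1) ^ 2 * G / q ^ 2,
  (q - 1) * (2 * q - 1) * N / q ^ 3 + (q - 1) * G / q ^ 2,
  (q - 1) * (2 * q - 1) * N / q ^ 3]

omit [Fintype K] [Fintype V] in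
theorem polarBilin_eq_smul (h2 : (2 : K) ≠ 0) (Q : QuadraticForm K V) {u c : V} {t : K}
    (h : Q.polarBilin c = t • Q.polarBilin u) :
    Q c = t * t * Q u ∧ Q.polarBilin u c = 2 * t * Q u := by
  have h' : Q.polarBilin c = Q.polarBilin (t • u) := by rw [h, map_smul]
  constructor
  · rw [eq_of_polarBilin_eq h2 Q h', QuadraticMap.map_smul, smul_eq_mul]
  · rw [polarBilin_comm, h, LinearMap.smul_apply, polarBilin_self, smul_eq_mul]
    ring

omit [Fintype K] [Fintype V] in
theorem planeDisc_eq_zero_of_smul (h2 : (2 : K) ≠ 0) (Q : QuadraticForm K V) {u c : V} {t : K}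
    (h : Q.polarBilin c = t • Q.polarBilin u) : planeDisc Q u c = 0 := by
  obtain ⟨h1, h1'⟩ := polarBilin_eq_smul h2 Q h
  rw [planeDisc, h1, h1']
  ring

omit [Fintype K] [Fintype V] in
theorem unionWeight_zero (Q : QuadraticForm K V) (f : Dual K V) : unionWeight Q f 0 = 0 := by
  simp [unionWeight]

omit [Fintype K] [Fintype V] in
theorem polarBilin_ne_zero_of_ne_zero (h2 : (2 : K) ≠ 0) (Q : QuadraticForm K V) {u : V}
    (hu : Q u ≠ 0) : Q.polarBilin u ≠ 0 :=
  fun h => hu (eq_zero_of_polarBilin_eq_zero h2 Q h)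

/-- For `g` independent of `f` the coefficient of the Gauss value depends on whether `Q c = 0` and
on the character of the discriminant. An unrepresented `g` and one with `Q c ≠ 0` and nonsquare
discriminant give the same coefficient, which is why they share the last class. -/
theorem unionWeight_of_anisotropicClass [DecidableEq K] (h2 : (2 : K) ≠ 0)
    {Q : QuadraticForm K V} (hQ : IsBalanced Q) {u : V} (hu : Q u ≠ 0) (i : Fin 7) (g : Dual K V)
    (h : anisotropicClass Q u i g) : (unionWeight Q (Q.polarBilin u) g : ℚ) =
      anisotropicWeight (Fintype.card K) (Fintype.card V) (gaussValue Q) i := by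
  have hf : Q.polarBilin u ≠ 0 := polarBilin_ne_zero_of_ne_zero h2 Q hu
  have hq : (Fintype.card K : ℚ) ≠ 0 := by exact_mod_cast Fintype.card_ne_zero
  have hline : lineSign Q (Q.polarBilin u) = 0 := by rw [lineSign_polarBilin h2, if_neg hu]
  have hind : ∀ (hg : ∀ t : K, g ≠ t • Q.polarBilin u), _ :=
    fun hg => unionWeight_of_independent h2 hQ hf hg
  rw [hline] at hind
  have hplane := planeSign_of_ne_zero h2 Q hu
  fin_cases i
  · obtain rfl : g = 0 := h
    simp [anisotropicWeight, unionWeight_zero]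
  · obtain ⟨t, ht, rfl⟩ := h
    have hw := unionWeight_smul h2 hQ hf ht
    rw [hline] at hw
    simp only [anisotropicWeight, Fin.mk_one, Matrix.cons_val]
    field_simp
    linear_combination hw
  · obtain ⟨c, rfl, ⟨hc, hfc⟩, h0⟩ := h
    have hw := hind fun t ht => h0 (by
      have := (polarBilin_eq_smul h2 Q ht).2
      rw [hfc] at this
      have ht0 : t = 0 := by simpa [h2, hu] using this.symm
      rw [ht, ht0, zero_smul])
    rw [hplane, lineSign_polarBilin h2, if_pos hc, hfc, hc] at hw
    simp only [anisotropicWeight, Matrix.cons_val, Fin.reduceFinMk]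
    field_simp
    simp at hw
    linear_combination hw
  · obtain ⟨c, rfl, hc, hfc⟩ := h
    have hw := hind fun t ht => hfc (by
      obtain ⟨h1, h1'⟩ := polarBilin_eq_smul h2 Q ht
      rw [hc] at h1
      have ht0 : t = 0 := by simpa [hu] using h1.symm
      rw [h1', ht0]
      ring)
    rw [hplane, lineSign_polarBilin h2, if_pos hc, hc, mul_zero (4 * Q u), sub_zero,
      quadraticChar_sq_one' hfc] at hw
    simp only [anisotropicWeight, Matrix.cons_val, Fin.reduceFinMk]
    field_simp
    push_cast at hw
    linear_combination hw
  · obtain ⟨⟨c, rfl, hfc, hd⟩, h1⟩ := h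
    have hc : Q c ≠ 0 := by
      intro hc
      rw [planeDisc, hc] at hd
      exact hfc (by simpa using hd)
    have hw := hind fun t ht => h1 ⟨t, by
      rintro rfl
      rw [zero_smul] at ht
      exact hc (eq_zero_of_polarBilin_eq_zero h2 Q ht), ht⟩
    rw [hplane, lineSign_polarBilin h2, if_neg hc, ← planeDisc, hd] at hw
    simp only [anisotropicWeight, Matrix.cons_val, Fin.reduceFinMk]
    field_simp
    simp at hw
    linear_combination hw
  · obtain ⟨c, rfl, hd, hc⟩ := h
    have hw := hind fun t ht => by
      rw [planeDisc_eq_zero_of_smul h2 Q ht] at hd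
      simp at hd
    rw [hplane, lineSign_polarBilin h2, if_neg hc, ← planeDisc, hd] at hw
    simp only [anisotropicWeight, Matrix.cons_val, Fin.reduceFinMk]
    field_simp
    push_cast at hw
    linear_combination hw
  · obtain ⟨hg, hg' | ⟨c, rfl, hc, hd⟩⟩ := h
    · have hw := hind hg
      rw [planeSign_of_not_exists Q u hg', lineSign_of_not_exists h2 Q hg', hline] at hw
      simp only [anisotropicWeight, Matrix.cons_val, Fin.reduceFinMk]
      field_simp
      linear_combination hw
    · have hw := hind hg
      rw [hplane, lineSign_polarBilin h2, if_neg hc, ← planeDisc, hd] at hw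
      simp only [anisotropicWeight, Matrix.cons_val, Fin.reduceFinMk]
      field_simp
      push_cast at hw
      linear_combination hw

/-- In the last class the coefficient of the Gauss value cancels, whether `g` is unrepresented or is
`B(c, ·)` with `B(u, c) = 0`, and then for either value of `Q c = 0`. -/
theorem unionWeight_of_isotropicClass (h2 : (2 : K) ≠ 0)
    {Q : QuadraticForm K V} (hQ : IsBalanced Q) {u : V} (hu : Q u = 0) (hf : Q.polarBilin u ≠ 0)
    (i : Fin 5) (g : Dual K V)
    (h : isotropicClass Q u i g) : (unionWeight Q (Q.polarBilin u) g : ℚ) =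
      isotropicWeight (Fintype.card K) (Fintype.card V) (gaussValue Q) i := by
  have hq : (Fintype.card K : ℚ) ≠ 0 := by exact_mod_cast Fintype.card_ne_zero
  have hline : lineSign Q (Q.polarBilin u) = (Fintype.card K : ℚ) * (Fintype.card K - 1) := by
    rw [lineSign_polarBilin h2, if_pos hu]
  have hind : ∀ (hg : ∀ t : K, g ≠ t • Q.polarBilin u), _ :=
    fun hg => unionWeight_of_independent h2 hQ hf hg
  rw [hline] at hind
  have hplane := planeSign_of_eq_zero h2 Q hu
  fin_cases i
  · obtain rfl : g = 0 := h
    simp [isotropicWeight, unionWeight_zero]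
  · obtain ⟨t, ht, rfl⟩ := h
    have hw := unionWeight_smul h2 hQ hf ht
    rw [hline] at hw
    simp only [isotropicWeight, Fin.mk_one, Matrix.cons_val]
    field_simp
    linear_combination hw
  · obtain ⟨c, rfl, hc, hfc⟩ := h
    have hw := hind fun t ht => hfc (by rw [(polarBilin_eq_smul h2 Q ht).2, hu, mul_zero])
    rw [hplane, lineSign_polarBilin h2, if_pos hc, if_neg hfc] at hw
    simp only [isotropicWeight, Matrix.cons_val, Fin.reduceFinMk]
    field_simp
    linear_combination hw
  · obtain ⟨c, rfl, hfc, hc⟩ := h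
    have hw := hind fun t ht => hfc (by rw [(polarBilin_eq_smul h2 Q ht).2, hu, mul_zero])
    rw [hplane, lineSign_polarBilin h2, if_neg hc, if_neg hfc] at hw
    simp only [isotropicWeight, Matrix.cons_val, Fin.reduceFinMk]
    field_simp
    linear_combination hw
  · obtain ⟨hg, hg' | ⟨c, rfl, hfc⟩⟩ := h
    · have hw := hind hg
      rw [planeSign_of_not_exists Q u hg', lineSign_of_not_exists h2 Q hg', hline] at hw
      simp only [isotropicWeight, Matrix.cons_val, Fin.reduceFinMk]
      field_simp
      linear_combination hw
    · have hw := hind hg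
      rw [hplane, lineSign_polarBilin h2, if_pos hfc] at hw
      simp only [isotropicWeight, Matrix.cons_val, Fin.reduceFinMk]
      field_simp
      split_ifs at hw <;> linear_combination hw

end WeightClasses

/-! ### Sizes of the classes -/

section WeightCounts

open Finset Module

variable {K V : Type*} [Field K] [Fintype K] [AddCommGroup V] [Module K V] [Fintype V]

/-- Sizes of the classes `anisotropicClass`, in terms of `q = |K|`, `N = |V|`, the Gauss value `G`
and the size `r` of the radical. -/
def anisotropicFreq (q N G r : ℚ) : Fin 7 → ℚ := ![
  1,
  q - 1,
  N / (q ^ 2 * r) - 1,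
  (q - 1) * (N + q * G) / (q ^ 2 * r),
  (q - 1) * (N / (q ^ 2 * r) - 1),
  (q - 2) / 2 * ((q - 1) * (N + q * G) / (q ^ 2 * r)),
  N - N / (2 * r) - N / (2 * q * r) - (q - 1) * G / (2 * r)]

/-- Sizes of the classes `isotropicClass`, in terms of `q = |K|`, `N = |V|`, the Gauss value `G`
and the size `r` of the radical. -/
def isotropicFreq (q N r : ℚ) : Fin 5 → ℚ := ![
  1,
  q - 1,
  (q - 1) * N / (q ^ 2 * r),
  (q - 1) ^ 2 * N / (q ^ 2 * r),
  N - q - (q - 1) * N / (q * r)]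

omit [Fintype K] in
theorem ncard_radical_ne_zero (Q : QuadraticForm K V) :
    (Set.ncard {r | Q.polarBilin r = 0} : ℚ) ≠ 0 := by
  rw [Nat.cast_ne_zero]
  exact Set.ncard_ne_zero_of_mem (a := 0) (by simp)

theorem ncard_and_ne {α : Type*} [Finite α] (P S : α → Prop) :
    (Set.ncard {x | P x ∧ ¬ S x} : ℚ) = Set.ncard {x | P x} - Set.ncard {x | P x ∧ S x} := by
  have := ncard_inter_add_ncard_diff P S
  rw [← this]
  push_cast
  ring

/-- Since `Q u ≠ 0`, the line sum of `f` is 0, so `Q` has exactly `N / q^2` zeros on the kernel of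
`f`. Removing the radical, which is contained among them, removes `g = 0`. -/
theorem ncard_isotropic_polar_zero (h2 : (2 : K) ≠ 0)
    {Q : QuadraticForm K V} (hQ : IsBalanced Q) {u : V} (hu : Q u ≠ 0) :
    (Set.ncard {g | ∃ c, Q.polarBilin c = g ∧ (Q c = 0 ∧ Q.polarBilin u c = 0) ∧
      Q.polarBilin c ≠ 0} : ℚ) = Fintype.card V /
        (Fintype.card K ^ 2 * Set.ncard {r | Q.polarBilin r = 0}) - 1 := by
  have hf := polarBilin_ne_zero_of_ne_zero h2 Q hu
  have hq : (Fintype.card K : ℚ) ≠ 0 := by exact_mod_cast Fintype.card_ne_zero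
  have hr := ncard_radical_ne_zero Q
  have himg := ncard_radical_mul_ncard_image Q
    (P := fun c => (Q c = 0 ∧ Q.polarBilin u c = 0) ∧ ¬ Q.polarBilin c = 0)
    (fun c r hr ⟨⟨h1, h1'⟩, h1''⟩ => ⟨⟨by rw [map_add_radical h2 hr, h1],
      by rw [map_add, h1', polarBilin_apply_radical hr, add_zero]⟩,
      by rwa [map_add, hr, add_zero]⟩)
  rw [ncard_and_ne] at himg
  have hrad : {c | (Q c = 0 ∧ Q.polarBilin u c = 0) ∧ Q.polarBilin c = 0} =
      {r | Q.polarBilin r = 0} := by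
    ext c
    exact ⟨fun h => h.2, fun h => ⟨⟨eq_zero_of_polarBilin_eq_zero h2 Q h,
      polarBilin_apply_radical h u⟩, h⟩⟩
  rw [hrad] at himg
  have hz := card_mul_ncard_zeros_dual h2 hQ hf
  rw [lineSign_polarBilin h2, if_neg hu] at hz
  field_simp
  linear_combination (Fintype.card K : ℚ) ^ 2 * himg + hz

theorem ncard_zeros_and_ne (h2 : (2 : K) ≠ 0)
    {Q : QuadraticForm K V} (hQ : IsBalanced Q) {u : V} (hf : Q.polarBilin u ≠ 0) :
    (Fintype.card K : ℚ) ^ 2 * Set.ncard {c | Q c = 0 ∧ ¬ Q.polarBilin u c = 0} =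
      (Fintype.card K - 1) * Fintype.card V + gaussValue Q *
        (Fintype.card K * (Fintype.card K - 1) - lineSign Q (Q.polarBilin u)) := by
  rw [ncard_and_ne]
  linear_combination (Fintype.card K : ℚ) * card_mul_ncard_zeros_univ hQ -
    card_mul_ncard_zeros_dual h2 hQ hf

omit [Fintype K] in
theorem ncard_radical_mul_ncard_zero_polar_ne (h2 : (2 : K) ≠ 0) (Q : QuadraticForm K V) (u : V) :
    (Set.ncard {r | Q.polarBilin r = 0} : ℚ) *
      Set.ncard {g | ∃ c, Q.polarBilin c = g ∧ Q c = 0 ∧ Q.polarBilin u c ≠ 0} =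
      Set.ncard {c | Q c = 0 ∧ ¬ Q.polarBilin u c = 0} :=
  ncard_radical_mul_ncard_image Q (P := fun c => Q c = 0 ∧ ¬ Q.polarBilin u c = 0)
    (fun c r hr ⟨h1, h1'⟩ => ⟨by rw [map_add_radical h2 hr, h1],
      by rwa [map_add, polarBilin_apply_radical hr, add_zero]⟩)

omit [Fintype K] [Fintype V] in
theorem planeDisc_add_radical (h2 : (2 : K) ≠ 0) (Q : QuadraticForm K V) (u c : V) {r : V}
    (hr : Q.polarBilin r = 0) : planeDisc Q u (c + r) = planeDisc Q u c := by
  rw [planeDisc, map_add_radical h2 hr, map_add, polarBilin_apply_radical hr, add_zero, planeDisc]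

omit [Fintype K] [Fintype V] in
theorem four_ne_zero_of_two_ne_zero (h2 : (2 : K) ≠ 0) : (4 : K) ≠ 0 := by
  rw [show (4 : K) = 2 * 2 by norm_num]
  exact mul_ne_zero h2 h2

/-- Each of the `q - 1` slices `B(u, c) = s ≠ 0` is a translate of the kernel of `f`, where zero
discriminant means `Q w = 0`. The nonzero multiples of `f` all occur and are subtracted. -/
theorem ncard_zero_disc (h2 : (2 : K) ≠ 0)
    {Q : QuadraticForm K V} (hQ : IsBalanced Q) {u : V} (hu : Q u ≠ 0) :
    (Set.ncard {g | (∃ c, Q.polarBilin c = g ∧ Q.polarBilin u c ≠ 0 ∧ planeDisc Q u c = 0) ∧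
      ¬ ∃ t : K, t ≠ 0 ∧ g = t • Q.polarBilin u} : ℚ) = (Fintype.card K - 1) * (Fintype.card V /
        (Fintype.card K ^ 2 * Set.ncard {r | Q.polarBilin r = 0}) - 1) := by
  classical
  have hf := polarBilin_ne_zero_of_ne_zero h2 Q hu
  have hq : (Fintype.card K : ℚ) ≠ 0 := by exact_mod_cast Fintype.card_ne_zero
  have hr := ncard_radical_ne_zero Q
  have hfin : Finite (Dual K V) := Module.finite_of_finite K
  rw [ncard_and_ne]
  have hmul : {g | (∃ c, Q.polarBilin c = g ∧ Q.polarBilin u c ≠ 0 ∧ planeDisc Q u c = 0) ∧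
      ∃ t : K, t ≠ 0 ∧ g = t • Q.polarBilin u} = {g | ∃ t : K, t ≠ 0 ∧ g = t • Q.polarBilin u} := by
    ext g
    refine ⟨fun h => h.2, fun h => ⟨?_, h⟩⟩
    obtain ⟨t, ht, rfl⟩ := h
    have ht' : Q.polarBilin (t • u) = t • Q.polarBilin u := map_smul _ _ _
    refine ⟨t • u, ht', ?_, planeDisc_eq_zero_of_smul h2 Q ht'⟩
    rw [(polarBilin_eq_smul h2 Q ht').2]
    exact mul_ne_zero (mul_ne_zero h2 ht) hu
  rw [hmul, ncard_nonzero_multiples hf]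
  have himg := ncard_radical_mul_ncard_image Q
    (P := fun c => Q.polarBilin u c ≠ 0 ∧ planeDisc Q u c = 0)
    (fun c r hr ⟨h1, h1'⟩ => ⟨by rwa [map_add, polarBilin_apply_radical hr, add_zero],
      by rw [planeDisc_add_radical h2 Q u c hr, h1']⟩)
  have hcount := ncard_setOf_polarBilin_planeDisc h2 Q hu (fun s d => s ≠ 0 ∧ d = 0)
  have hset : {w | Q.polarBilin u w = 0 ∧ planeDisc Q u w = 0} =
      {w | Q w = 0 ∧ Q.polarBilin u w = 0} := by
    ext w
    have h4 := four_ne_zero_of_two_ne_zero h2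
    constructor
    · rintro ⟨h1, h1'⟩
      rw [planeDisc, h1] at h1'
      exact ⟨by simpa [h4, hu] using h1', h1⟩
    · rintro ⟨h1, h1'⟩
      exact ⟨h1', by rw [planeDisc, h1, h1']; ring⟩
  have hterm : ∀ s ∈ univ.erase (0 : K),
      Set.ncard {w | Q.polarBilin u w = 0 ∧ s ≠ 0 ∧ planeDisc Q u w = 0} =
        Set.ncard {w | Q w = 0 ∧ Q.polarBilin u w = 0} := by
    intro s hs
    have hs : s ≠ 0 := Finset.ne_of_mem_erase hs
    simp only [hs, ne_eq, not_false_eq_true, true_and]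
    rw [hset]
  rw [← Finset.add_sum_erase _ _ (mem_univ (0 : K)), Finset.sum_congr rfl hterm] at hcount
  have hpos : 1 ≤ Fintype.card K := Fintype.card_pos
  simp only [ne_eq, not_true_eq_false, false_and, and_false, Set.ofPred_false, Set.ncard_empty,
    zero_add, Finset.sum_const, Finset.card_erase_of_mem (mem_univ (0 : K)), Finset.card_univ,
    smul_eq_mul] at hcount
  have hcount' : (Set.ncard {c | ¬ Q.polarBilin u c = 0 ∧ planeDisc Q u c = 0} : ℚ) =
      (Fintype.card K - 1) * Set.ncard {w | Q w = 0 ∧ Q.polarBilin u w = 0} := by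
    rw [hcount]
    push_cast [Nat.cast_sub hpos]
    ring
  simp only [ne_eq] at himg ⊢
  rw [hcount'] at himg
  have hz := card_mul_ncard_zeros_dual h2 hQ hf
  rw [lineSign_polarBilin h2, if_neg hu] at hz
  field_simp
  linear_combination (Fintype.card K : ℚ) ^ 2 * himg + ((Fintype.card K : ℚ) - 1) * hz

/-- Project along `u` to `w` with `B(u, w) = 0`. A `w` whose discriminant is a nonzero square has
`q` lifts on the left. On the right, `Q c = 0` means that the discriminant is `B(u, c)^2`, so the
same `w` has two lifts, one for each square root. -/
theorem two_mul_ncard_square_planeDisc [DecidableEq K] (h2 : (2 : K) ≠ 0) (Q : QuadraticForm K V)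
    {u : V} (hu : Q u ≠ 0) :
    2 * Set.ncard {c | quadraticChar K (planeDisc Q u c) = 1} =
      Fintype.card K * Set.ncard {c | Q c = 0 ∧ ¬ Q.polarBilin u c = 0} := by
  classical
  have h1 := ncard_setOf_polarBilin_planeDisc h2 Q hu (fun _ d => quadraticChar K d = 1)
  have h3 := ncard_setOf_polarBilin_planeDisc h2 Q hu (fun s d => s ≠ 0 ∧ d = s ^ 2)
  have hset : {c | Q.polarBilin u c ≠ 0 ∧ planeDisc Q u c = Q.polarBilin u c ^ 2} =
      {c | Q c = 0 ∧ ¬ Q.polarBilin u c = 0} := by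
    ext c
    have h4 := four_ne_zero_of_two_ne_zero h2
    simp only [Set.mem_ofPred_eq, planeDisc, sub_eq_self, mul_eq_zero, h4, hu, false_or, ne_eq]
    exact and_comm
  rw [hset] at h3
  have h5 : ∑ s : K, Set.ncard {w | Q.polarBilin u w = 0 ∧ s ≠ 0 ∧ planeDisc Q u w = s ^ 2} =
      2 * Set.ncard {w | Q.polarBilin u w = 0 ∧ quadraticChar K (planeDisc Q u w) = 1} := by
    have hc := fun P : V → Prop => ncard_setOf_eq_sum (R := ℕ) P
    simp only [Nat.cast_id] at hc
    simp_rw [hc]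
    rw [Finset.sum_comm, Finset.mul_sum]
    refine Finset.sum_congr rfl fun w _ => ?_
    have hs := ncard_nonzero_sqrts h2 (planeDisc Q u w)
    have hk := ncard_setOf_eq_sum (R := ℕ) (fun s : K => s ≠ 0 ∧ planeDisc Q u w = s ^ 2)
    rw [Nat.cast_id, hs] at hk
    by_cases hw : Q.polarBilin u w = 0
    · simp only [hw, true_and, ← hk, mul_ite, mul_one, mul_zero]
    · simp only [hw, false_and, if_false, Finset.sum_const_zero, mul_zero]
  rw [h3, h5, h1]
  simp
  ring

/-- If `Q c = 0`, the discriminant is `B(u, c)^2`, so the vectors to discard are the isotropic ones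
with `B(u, c) ≠ 0`: this leaves `q/2 - 1` times their number. -/
theorem ncard_radical_mul_ncard_square_disc [DecidableEq K] (h2 : (2 : K) ≠ 0)
    (Q : QuadraticForm K V) {u : V} (hu : Q u ≠ 0) :
    (Set.ncard {r | Q.polarBilin r = 0} : ℚ) *
      Set.ncard {g | ∃ c, Q.polarBilin c = g ∧ quadraticChar K (planeDisc Q u c) = 1 ∧ Q c ≠ 0} =
      (Fintype.card K - 2) / 2 * Set.ncard {c | Q c = 0 ∧ ¬ Q.polarBilin u c = 0} := by
  have himg := ncard_radical_mul_ncard_image Q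
    (P := fun c => quadraticChar K (planeDisc Q u c) = 1 ∧ ¬ Q c = 0)
    (fun c r hr ⟨h1, h1'⟩ => ⟨by rw [planeDisc_add_radical h2 Q u c hr, h1],
      by rwa [map_add_radical h2 hr]⟩)
  rw [ncard_and_ne] at himg
  have hset : {c | quadraticChar K (planeDisc Q u c) = 1 ∧ Q c = 0} =
      {c | Q c = 0 ∧ ¬ Q.polarBilin u c = 0} := by
    ext c
    simp only [Set.mem_ofPred_eq, planeDisc]
    rw [and_comm]
    refine and_congr_right fun hc => ?_
    rw [hc, mul_zero (4 * Q u), sub_zero]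
    constructor
    · intro h h0
      rw [h0] at h
      simp at h
    · exact fun h => quadraticChar_sq_one' h
  rw [hset] at himg
  have h := two_mul_ncard_square_planeDisc h2 Q hu
  have h' : (2 : ℚ) * Set.ncard {c | quadraticChar K (planeDisc Q u c) = 1} =
      Fintype.card K * Set.ncard {c | Q c = 0 ∧ ¬ Q.polarBilin u c = 0} := by exact_mod_cast h
  linear_combination himg + h' / 2

theorem sum_ncard_weight_dual {ι : Type*} [Fintype ι] {wt : Dual K V → ℚ} {w : ι → ℚ}
    (hw : Function.Injective w) (hcover : ∀ g, ∃ i, wt g = w i) :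
    ∑ i, (Set.ncard {g | wt g = w i} : ℚ) = Fintype.card V := by
  have hfin : Finite (Dual K V) := Module.finite_of_finite K
  have := Fintype.ofFinite (Dual K V)
  rw [sum_ncard_weight hw hcover, card_eq_pow_finrank (K := K) (V := Dual K V),
    card_eq_pow_finrank (K := K) (V := V), Subspace.dual_finrank_eq]

theorem ncard_anisotropic_weight (h2 : (2 : K) ≠ 0)
    {Q : QuadraticForm K V} (hQ : IsBalanced Q) {u : V} (hu : Q u ≠ 0)
    (hw : Function.Injective
      (anisotropicWeight (Fintype.card K) (Fintype.card V) (gaussValue Q))) (i : Fin 7) :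
    (Set.ncard {g | (unionWeight Q (Q.polarBilin u) g : ℚ) =
      anisotropicWeight (Fintype.card K) (Fintype.card V) (gaussValue Q) i} : ℚ) =
      anisotropicFreq (Fintype.card K) (Fintype.card V) (gaussValue Q)
        (Set.ncard {r | Q.polarBilin r = 0}) i := by
  classical
  have hq : (Fintype.card K : ℚ) ≠ 0 := by exact_mod_cast Fintype.card_ne_zero
  have hr := ncard_radical_ne_zero Q
  have hf := polarBilin_ne_zero_of_ne_zero h2 Q hu
  have hclass := setOf_weight_eq_setOf_class hw (exists_anisotropicClass h2 Q hu)
    (unionWeight_of_anisotropicClass h2 hQ hu)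
  have hz := ncard_zeros_and_ne h2 hQ hf
  rw [lineSign_polarBilin h2, if_neg hu] at hz
  have c0 : (Set.ncard {g | anisotropicClass Q u 0 g} : ℚ) = 1 := by
    rw [show {g | anisotropicClass Q u 0 g} = {0} from rfl, Set.ncard_singleton, Nat.cast_one]
  have c1 : (Set.ncard {g | anisotropicClass Q u 1 g} : ℚ) = _ := ncard_nonzero_multiples hf
  have c2 : (Set.ncard {g | anisotropicClass Q u 2 g} : ℚ) = _ := ncard_isotropic_polar_zero h2 hQ hu
  have c3 : (Set.ncard {g | anisotropicClass Q u 3 g} : ℚ) =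
      (Fintype.card K - 1) * (Fintype.card V + Fintype.card K * gaussValue Q) /
        (Fintype.card K ^ 2 * Set.ncard {r | Q.polarBilin r = 0}) := by
    have h : _ * (Set.ncard {g | anisotropicClass Q u 3 g} : ℚ) = _ :=
      ncard_radical_mul_ncard_zero_polar_ne h2 Q u
    rw [eq_div_iff (by positivity)]
    linear_combination (Fintype.card K : ℚ) ^ 2 * h + hz
  have c4 : (Set.ncard {g | anisotropicClass Q u 4 g} : ℚ) = _ := ncard_zero_disc h2 hQ hu
  have c5 : (Set.ncard {g | anisotropicClass Q u 5 g} : ℚ) = (Fintype.card K - 2) / 2 *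
      ((Fintype.card K - 1) * (Fintype.card V + Fintype.card K * gaussValue Q) /
        (Fintype.card K ^ 2 * Set.ncard {r | Q.polarBilin r = 0})) := by
    have h : _ * (Set.ncard {g | anisotropicClass Q u 5 g} : ℚ) = _ :=
      ncard_radical_mul_ncard_square_disc h2 Q hu
    rw [← mul_div_assoc, eq_div_iff (by positivity)]
    linear_combination (Fintype.card K : ℚ) ^ 2 * h + (Fintype.card K - 2) / 2 * hz
  rw [hclass i]
  fin_cases i
  · exact c0
  · exact c1
  · exact c2
  · exact c3
  · exact c4
  · exact c5
  -- The last class has no direct count: it is the complement of the others in the dual, which has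
  -- `|V|` elements.
  · have hsum := sum_ncard_weight_dual hw
      (wt := fun g => (unionWeight Q (Q.polarBilin u) g : ℚ)) (fun g => by
        obtain ⟨j, hj⟩ := exists_anisotropicClass h2 Q hu g
        exact ⟨j, unionWeight_of_anisotropicClass h2 hQ hu j g hj⟩)
    simp only [hclass] at hsum
    rw [Fin.sum_univ_seven, c0, c1, c2, c3, c4, c5] at hsum
    simp only [Fin.reduceFinMk, anisotropicFreq, Matrix.cons_val]
    rw [← eq_sub_iff_add_eq'] at hsum
    rw [hsum]
    field_simp
    ring

theorem ncard_isotropic_weight (h2 : (2 : K) ≠ 0)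
    {Q : QuadraticForm K V} (hQ : IsBalanced Q) {u : V} (hu : Q u = 0) (hf : Q.polarBilin u ≠ 0)
    (hw : Function.Injective
      (isotropicWeight (Fintype.card K) (Fintype.card V) (gaussValue Q))) (i : Fin 5) :
    (Set.ncard {g | (unionWeight Q (Q.polarBilin u) g : ℚ) =
      isotropicWeight (Fintype.card K) (Fintype.card V) (gaussValue Q) i} : ℚ) =
      isotropicFreq (Fintype.card K) (Fintype.card V)
        (Set.ncard {r | Q.polarBilin r = 0}) i := by
  have hq : (Fintype.card K : ℚ) ≠ 0 := by exact_mod_cast Fintype.card_ne_zero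
  have hr := ncard_radical_ne_zero Q
  have hclass := setOf_weight_eq_setOf_class hw (exists_isotropicClass Q u)
    (unionWeight_of_isotropicClass h2 hQ hu hf)
  have hz := ncard_zeros_and_ne h2 hQ hf
  rw [lineSign_polarBilin h2, if_pos hu, sub_self, mul_zero, add_zero] at hz
  have c0 : (Set.ncard {g | isotropicClass Q u 0 g} : ℚ) = 1 := by
    rw [show {g | isotropicClass Q u 0 g} = {0} from rfl, Set.ncard_singleton, Nat.cast_one]
  have c1 : (Set.ncard {g | isotropicClass Q u 1 g} : ℚ) = _ := ncard_nonzero_multiples hf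
  have c2 : (Set.ncard {g | isotropicClass Q u 2 g} : ℚ) =
      (Fintype.card K - 1) * Fintype.card V /
        (Fintype.card K ^ 2 * Set.ncard {r | Q.polarBilin r = 0}) := by
    have h : _ * (Set.ncard {g | isotropicClass Q u 2 g} : ℚ) = _ :=
      ncard_radical_mul_ncard_zero_polar_ne h2 Q u
    rw [eq_div_iff (by positivity)]
    linear_combination (Fintype.card K : ℚ) ^ 2 * h + hz
  have c3 : (Set.ncard {g | isotropicClass Q u 3 g} : ℚ) =
      (Fintype.card K - 1) ^ 2 * Fintype.card V /
        (Fintype.card K ^ 2 * Set.ncard {r | Q.polarBilin r = 0}) := by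
    have h : _ * (Set.ncard {g | isotropicClass Q u 3 g} : ℚ) = _ :=
      ncard_radical_mul_ncard_image Q (P := fun c => Q.polarBilin u c ≠ 0 ∧ ¬ Q c = 0)
        (fun c r hr ⟨h1, h1'⟩ => ⟨by rwa [map_add, polarBilin_apply_radical hr, add_zero],
          by rwa [map_add_radical h2 hr]⟩)
    -- All vectors off the kernel of `f` are counted first; the isotropic ones among them are then
    -- removed.
    have h' := ncard_and_ne (fun _ : V => True) (fun c => Q.polarBilin u c = 0)
    simp only [true_and, Set.ofPred_true, Set.ncard_univ, Nat.card_eq_fintype_card] at h'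
    have hcomm : {c | Q.polarBilin u c ≠ 0 ∧ Q c = 0} = {c | Q c = 0 ∧ ¬ Q.polarBilin u c = 0} := by
      ext c
      exact and_comm
    rw [ncard_and_ne, hcomm] at h
    simp only [ne_eq] at h
    rw [h'] at h
    rw [eq_div_iff (by positivity)]
    linear_combination (Fintype.card K : ℚ) ^ 2 * h - hz -
      (Fintype.card K : ℚ) * card_mul_ncard_dual_eq_zero hf
  rw [hclass i]
  fin_cases i
  · exact c0
  · exact c1
  · exact c2
  · exact c3
  · have hsum := sum_ncard_weight_dual hw
      (wt := fun g => (unionWeight Q (Q.polarBilin u) g : ℚ)) (fun g => by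
        obtain ⟨j, hj⟩ := exists_isotropicClass Q u g
        exact ⟨j, unionWeight_of_isotropicClass h2 hQ hu hf j g hj⟩)
    simp only [hclass] at hsum
    rw [Fin.sum_univ_five, c0, c1, c2, c3] at hsum
    simp only [Fin.reduceFinMk, isotropicFreq, Matrix.cons_val]
    rw [← eq_sub_iff_add_eq'] at hsum
    rw [hsum]
    field_simp
    ring

end WeightCounts

/-! ### From weights and frequencies to code parameters -/

section CodeFromWeights

open Module

variable {K W : Type*} [Field K] [DecidableEq K] [AddCommGroup W] [Module K W] {n k : ℕ}

theorem injective_of_ncard_eq_one {φ : W →ₗ[K] (Fin n → K)}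
    (h : Set.ncard {g | hammingNorm (φ g) = 0} = 1) : Function.Injective φ := by
  rw [injective_iff_map_eq_zero]
  intro g hg
  obtain ⟨a, ha⟩ := Set.ncard_eq_one.1 h
  have h1 : g ∈ ({a} : Set W) := ha ▸ (by simp [hg] : g ∈ {g | hammingNorm (φ g) = 0})
  have h2 : (0 : W) ∈ ({a} : Set W) := ha ▸ (by simp : (0 : W) ∈ {g | hammingNorm (φ g) = 0})
  rw [Set.mem_singleton_iff] at h1 h2
  rw [h1, h2]

theorem weightCount_range {φ : W →ₗ[K] (Fin n → K)} (hφ : Function.Injective φ) (v : ℕ) :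
    weightCount (LinearMap.range φ) v = Set.ncard {g | hammingNorm (φ g) = v} := by
  rw [weightCount, ← Set.ncard_image_of_injective _ hφ]
  congr 1
  ext c
  constructor
  · rintro ⟨⟨g, rfl⟩, hg⟩
    exact ⟨g, hg, rfl⟩
  · rintro ⟨g, hg, rfl⟩
    exact ⟨⟨g, rfl⟩, hg⟩

/-- The code parameters read off from the list of weights and frequencies of an encoder. -/
theorem code_of_weights [Finite W] (φ : W →ₗ[K] (Fin n → K)) {w fr : Fin (k + 2) → ℚ}
    (hw : Function.Injective w) (hw0 : w 0 = 0)
    (hcover : ∀ g, ∃ i, (hammingNorm (φ g) : ℚ) = w i)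
    (hcount : ∀ i, (Set.ncard {g | (hammingNorm (φ g) : ℚ) = w i} : ℚ) = fr i)
    (hfr0 : fr 0 = 1) (hfr : ∀ i, fr i ≠ 0) (hmin : ∀ i, i ≠ 0 → w 1 ≤ w i) :
    IsTWeight (LinearMap.range φ) (k + 1) ∧
    Module.finrank K (LinearMap.range φ) = Module.finrank K W ∧
    IsMinDistance (LinearMap.range φ) (w 1) ∧
    HasWeightDistribution (LinearMap.range φ) (List.ofFn fun i => (w i, fr i)) := by
  -- Weight 0 has frequency 1, so the kernel is trivial and codewords can be counted by their
  -- preimages.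
  have hφ : Function.Injective φ := by
    apply injective_of_ncard_eq_one
    have h := hcount 0
    rw [hw0, hfr0] at h
    simpa only [Nat.cast_eq_zero, Nat.cast_eq_one] using h
  have hattained : ∀ i, ∃ g, (hammingNorm (φ g) : ℚ) = w i := by
    intro i
    by_contra! h
    apply hfr i
    rw [← hcount i]
    simp [h]
  choose g hg using hattained
  have hval : ∀ i, (weightCount (LinearMap.range φ) (hammingNorm (φ (g i))) : ℚ) = fr i := by
    intro i
    rw [weightCount_range hφ, ← hcount i]
    congr 2
    ext x
    simp only [Set.mem_ofPred_eq, ← hg i, Nat.cast_inj]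
  refine ⟨?_, LinearMap.finrank_range_of_inj hφ, ⟨?_, ?_⟩, ?_, ?_, ?_⟩
  · have hset : {v : ℕ | 1 ≤ v ∧ weightCount (LinearMap.range φ) v ≠ 0} =
        Set.range fun i : Fin (k + 1) => hammingNorm (φ (g i.succ)) := by
      ext v
      constructor
      · rintro ⟨hv, hne⟩
        rw [weightCount_range hφ] at hne
        obtain ⟨x, hx⟩ := Set.nonempty_of_ncard_ne_zero hne
        obtain ⟨i, hi⟩ := hcover x
        rcases Fin.eq_zero_or_eq_succ i with rfl | ⟨j, rfl⟩
        · rw [hw0, Nat.cast_eq_zero] at hi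
          simp only [Set.mem_ofPred_eq] at hx
          omega
        · refine ⟨j, ?_⟩
          have : (hammingNorm (φ (g j.succ)) : ℚ) = v := by rw [hg, ← hi, hx]
          exact_mod_cast this
      · rintro ⟨j, rfl⟩
        constructor
        · rw [Nat.one_le_iff_ne_zero]
          intro h0
          have h1 := hg j.succ
          simp only [] at h0
          rw [h0, Nat.cast_zero, ← hw0] at h1
          exact Fin.succ_ne_zero j (hw h1).symm
        · intro h0
          have := hval j.succ
          simp only [] at h0
          rw [h0, Nat.cast_zero] at this
          exact hfr _ this.symm
    rw [IsTWeight, hset, Set.ncard_range_of_injective]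
    · simp
    · intro i j hij
      apply Fin.succ_injective
      apply hw
      simp only [] at hij
      rw [← hg, ← hg, hij]
  · refine ⟨φ (g 1), ⟨_, rfl⟩, 0, zero_mem _, ?_, ?_⟩
    · intro h0
      have h1 := hg 1
      rw [h0, hammingNorm_zero, Nat.cast_zero, ← hw0] at h1
      exact absurd (hw h1) (Fin.zero_ne_one)
    · rw [hammingDist_zero_right, hg]
  · rintro r ⟨x, ⟨a, rfl⟩, y, ⟨b, rfl⟩, hxy, rfl⟩
    rw [hammingDist_eq_hammingNorm, ← map_neg, ← map_add]
    obtain ⟨i, hi⟩ := hcover (-a + b)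
    rw [hi]
    apply hmin
    rintro rfl
    rw [hw0, Nat.cast_eq_zero, hammingNorm_eq_zero, map_add, map_neg,
      neg_add_eq_zero] at hi
    exact hxy hi
  · rw [List.map_ofFn, List.nodup_ofFn]
    exact hw
  · intro r hr
    obtain ⟨i, rfl⟩ := (List.mem_ofFn' _ _).1 hr
    exact ⟨_, hg i, hval i⟩
  · rintro _ ⟨a, rfl⟩
    rw [List.map_ofFn, List.mem_ofFn']
    obtain ⟨i, hi⟩ := hcover a
    exact ⟨i, hi.symm⟩

end CodeFromWeights

/-! ### Power maps in finite cyclic groups and finite fields -/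

section PowerMaps

theorem pow_pow_of_pow_eq_neg {L : Type*} [CommRing L] {N : ℕ} (hN : Odd N) {x : L}
    (hx : x ^ N = -x) (k : ℕ) : x ^ N ^ k = (-1) ^ k * x := by
  induction k with
  | zero => simp
  | succ k ih =>
    rw [pow_succ, pow_mul, ih, mul_pow, hx, ← pow_mul, mul_comm k N, pow_mul, hN.neg_one_pow]
    ring

theorem pow_pow_of_pow_sq_eq_self {L : Type*} [Monoid L] {N : ℕ} {x : L}
    (hx : x ^ N ^ 2 = x) {j : ℕ} (hj : Odd j) : x ^ N ^ j = x ^ N := by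
  obtain ⟨i, rfl⟩ := hj
  induction i with
  | zero => simp
  | succ i ih =>
    rw [show 2 * (i + 1) + 1 = 2 + (2 * i + 1) by ring, pow_add, pow_mul, hx, ih]

/-- Write `c` as the `i`-th power of a generator: `c ^ r = 1` gives `r * s ∣ r * i`, hence `s ∣ i`.
-/
theorem exists_pow_eq_of_pow_eq_one {G : Type*} [CommGroup G] [IsCyclic G] [Finite G] {r s : ℕ}
    (hr : r ≠ 0) (h : r * s ∣ Nat.card G) {c : G} (hc : c ^ r = 1) : ∃ y, y ^ s = c := by
  obtain ⟨w, hw⟩ := IsCyclic.exists_monoid_generator (α := G)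
  obtain ⟨i, rfl⟩ := (Submonoid.mem_powers_iff _ _).1 (hw c)
  have hord : orderOf w = Nat.card G := by
    rw [orderOf_eq_card_of_forall_mem_zpowers]
    intro x
    obtain ⟨a, rfl⟩ := (Submonoid.mem_powers_iff _ _).1 (hw x)
    exact ⟨a, by simp⟩
  simp only [← pow_mul] at hc
  have h1 : r * s ∣ r * i := by
    rw [mul_comm r i]
    exact (h.trans hord.symm.dvd).trans (orderOf_dvd_of_pow_eq_one hc)
  obtain ⟨t, rfl⟩ := Nat.dvd_of_mul_dvd_mul_left (Nat.pos_of_ne_zero hr) h1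
  exact ⟨w ^ t, by rw [← pow_mul, mul_comm]⟩

/-- The set is stable under the kernel of the `d`-th power map, hence a union of its cosets. -/
theorem card_dvd_ncard_of_forall_mul_mem {G : Type*} [CommGroup G] [Finite G] (d : ℕ)
    {P : G → Prop} (hP : ∀ z x, z ^ d = 1 → P x → P (z * x)) :
    Nat.card (powMonoidHom d : G →* G).ker ∣ Set.ncard {x | P x} := by
  classical
  have := Fintype.ofFinite G
  rw [Set.ncard_eq_toFinset_card', Set.toFinset_ofPred,
    Finset.card_eq_sum_card_image (powMonoidHom d : G →* G)]
  refine Finset.dvd_sum fun b hb => ?_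
  obtain ⟨c, hc, rfl⟩ := Finset.mem_image.1 hb
  simp only [Finset.mem_filter, Finset.mem_univ, true_and] at hc
  apply dvd_of_eq
  have hker : Nat.card (powMonoidHom d : G →* G).ker =
      (Finset.univ.filter fun z : G => z ^ d = 1).card := by
    rw [Nat.card_eq_fintype_card, Fintype.card_subtype]
    simp [MonoidHom.mem_ker]
  rw [hker]
  refine Finset.card_bij' (fun z _ => z * c) (fun x _ => x * c⁻¹) ?_ ?_ ?_ ?_
  · intro z hz
    simp only [Finset.mem_filter, Finset.mem_univ, true_and, powMonoidHom_apply] at hz ⊢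
    exact ⟨hP z c hz hc, by rw [mul_pow, hz, one_mul]⟩
  · intro x hx
    simp only [Finset.mem_filter, Finset.mem_univ, true_and, powMonoidHom_apply] at hx ⊢
    rw [mul_pow, hx.2, inv_pow, mul_inv_cancel]
  · intro z _
    simp
  · intro x _
    simp

/-- The nonzero solutions are the `(q^a - 1)`-torsion of a cyclic group of order `q^m - 1`, and
`gcd(q^m - 1, q^a - 1) = q^gcd(m, a) - 1`. -/
theorem ncard_pow_eq_self {L : Type*} [Field L] [Fintype L] {q m a : ℕ} (hq : 0 < q)
    (hL : Fintype.card L = q ^ m) : Set.ncard {z : L | z ^ q ^ a = z} = q ^ Nat.gcd m a := by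
  classical
  have hset : {z : L | z ^ q ^ a = z} =
      insert 0 (Units.val '' {z : Lˣ | z ^ (q ^ a - 1) = 1}) := by
    have hpos : 1 ≤ q ^ a := Nat.one_le_pow _ _ hq
    have hsucc : ∀ z : L, z ^ q ^ a = z ^ (q ^ a - 1) * z := fun z => by
      rw [← pow_succ, Nat.sub_add_cancel hpos]
    ext z
    simp only [Set.mem_ofPred_eq, Set.mem_insert_iff, Set.mem_image]
    constructor
    · intro h
      by_cases hz : z = 0
      · exact Or.inl hz
      · refine Or.inr ⟨Units.mk0 z hz, ?_, rfl⟩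
        ext
        rw [hsucc] at h
        simpa [hz] using h
    · rintro (rfl | ⟨z, hz, rfl⟩)
      · exact zero_pow (by omega)
      · rw [hsucc, ← Units.val_pow_eq_pow_val, hz, Units.val_one, one_mul]
  have hker : Set.ncard {z : Lˣ | z ^ (q ^ a - 1) = 1} = q ^ Nat.gcd m a - 1 := by
    have h := IsCyclic.card_powMonoidHom_ker Lˣ (q ^ a - 1)
    rw [Nat.card_units, Nat.card_eq_fintype_card (α := L), hL, Nat.pow_sub_one_gcd_pow_sub_one] at h
    rw [← h]
    rfl
  rw [hset, Set.ncard_insert_of_notMem, Set.ncard_image_of_injective _ Units.val_injective, hker,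
    Nat.sub_add_cancel (Nat.one_le_pow _ _ hq)]
  rintro ⟨z, _, hz⟩
  exact z.ne_zero hz

end PowerMaps

/-! ### The form `Tr(x^(q^e+1))`: balance, radical, Gauss value -/

section TraceForm

open Module

variable (K L : Type*) [Field K] [Fintype K] [Field L] [Algebra K L]

/-- The quadratic form `x ↦ Tr(x^(q^e+1))`. -/
noncomputable def powerTraceForm (e : ℕ) : QuadraticForm K L :=
  LinearMap.BilinMap.toQuadraticMap
    ((Algebra.traceForm K L).comp ((FiniteField.frobeniusAlgHom K L) ^ e).toLinearMap .id)

variable {K L}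

theorem frobeniusAlgHom_pow_apply (e : ℕ) (x : L) :
    ((FiniteField.frobeniusAlgHom K L) ^ e) x = x ^ Fintype.card K ^ e := by
  rw [AlgHom.coe_pow, FiniteField.coe_frobeniusAlgHom, pow_iterate]

theorem powerTraceForm_apply (e : ℕ) (x : L) :
    powerTraceForm K L e x = Algebra.trace K L (x ^ (Fintype.card K ^ e + 1)) := by
  simp only [powerTraceForm, LinearMap.BilinMap.toQuadraticMap_apply, LinearMap.BilinForm.comp_apply,
    AlgHom.toLinearMap_apply, frobeniusAlgHom_pow_apply, LinearMap.id_apply,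
    Algebra.traceForm_apply, pow_succ]

theorem polarBilin_powerTraceForm (e : ℕ) (x y : L) :
    (powerTraceForm K L e).polarBilin x y =
      Algebra.trace K L (x ^ Fintype.card K ^ e * y) +
        Algebra.trace K L (y ^ Fintype.card K ^ e * x) := by
  simp only [powerTraceForm, QuadraticMap.polarBilin_apply_apply,
    LinearMap.BilinMap.polar_toQuadraticMap, LinearMap.BilinForm.comp_apply,
    AlgHom.toLinearMap_apply, frobeniusAlgHom_pow_apply, LinearMap.id_apply,
    Algebra.traceForm_apply]

variable [Fintype L]

theorem trace_pow_card_pow (e : ℕ) (x : L) :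
    Algebra.trace K L (x ^ Fintype.card K ^ e) = Algebra.trace K L x := by
  have h := Algebra.trace_eq_of_algEquiv (FiniteField.frobeniusAlgEquivOfAlgebraic K L ^ e) x
  rwa [AlgEquiv.coe_pow, FiniteField.coe_frobeniusAlgEquivOfAlgebraic, pow_iterate] at h

/-- Frobenius fixes `1/2` and preserves the trace, so both terms of the polar form equal `Tr y / 2`.
-/
theorem polarBilin_powerTraceForm_algebraMap (h2 : (2 : K) ≠ 0) (e : ℕ) (y : L) :
    (powerTraceForm K L e).polarBilin (algebraMap K L 2⁻¹) y = Algebra.trace K L y := by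
  rw [polarBilin_powerTraceForm, ← map_pow, FiniteField.pow_card_pow, mul_comm (y ^ _),
    ← Algebra.smul_def, ← Algebra.smul_def, map_smul, map_smul, trace_pow_card_pow, smul_eq_mul]
  field_simp
  ring

theorem powerTraceForm_algebraMap (e : ℕ) :
    powerTraceForm K L e (algebraMap K L 2⁻¹) = (finrank K L : K) * (2⁻¹ * 2⁻¹) := by
  rw [powerTraceForm_apply, ← map_pow, pow_succ, FiniteField.pow_card_pow,
    Algebra.trace_algebraMap, nsmul_eq_mul]

/-- Applying `e` Frobenius steps to the first trace gives `B(r, y) = Tr((r^(q^(2e)) + r) y^(q^e))`.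
As `y^(q^e)` runs over `L`, nondegeneracy of the trace form applies. -/
theorem polarBilin_powerTraceForm_eq_zero_iff (e : ℕ) (r : L) :
    (powerTraceForm K L e).polarBilin r = 0 ↔ r ^ Fintype.card K ^ (2 * e) = -r := by
  have hexp : ∀ y, (powerTraceForm K L e).polarBilin r y =
      Algebra.trace K L ((r ^ Fintype.card K ^ (2 * e) + r) * y ^ Fintype.card K ^ e) := by
    intro y
    rw [polarBilin_powerTraceForm, ← trace_pow_card_pow e (r ^ Fintype.card K ^ e * y), mul_pow,
      ← pow_mul, ← pow_add, ← two_mul, ← map_add, add_mul, mul_comm r]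
  constructor
  · intro h
    rw [← sub_eq_zero, sub_neg_eq_add]
    apply (traceForm_nondegenerate K L).1
    intro y
    obtain ⟨z, rfl⟩ : ∃ z : L, z ^ Fintype.card K ^ e = y := by
      obtain ⟨z, hz⟩ := (FiniteField.frobeniusAlgEquivOfAlgebraic K L ^ e).surjective y
      rw [AlgEquiv.coe_pow, FiniteField.coe_frobeniusAlgEquivOfAlgebraic, pow_iterate] at hz
      exact ⟨z, hz⟩
    rw [Algebra.traceForm_apply, ← hexp, h, LinearMap.zero_apply]
  · intro h
    ext y
    rw [hexp, h, neg_add_cancel, zero_mul, map_zero, LinearMap.zero_apply]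

variable {g k j : ℕ}

theorem card_sub_one_mul_dvd {q : ℕ} : (q - 1) * (q ^ g + 1) ∣ q ^ (2 * (g * k)) - 1 := by
  have h1 : q - 1 ∣ q ^ g - 1 := by simpa using Nat.sub_dvd_pow_sub_pow q 1 g
  have h2 : (q ^ g - 1) * (q ^ g + 1) = q ^ (2 * g) - 1 := by
    rw [mul_comm, ← Nat.sq_sub_sq, one_pow, ← pow_mul, mul_comm g]
  have h3 : q ^ (2 * g) - 1 ∣ q ^ (2 * (g * k)) - 1 := by
    rw [← mul_assoc, pow_mul q (2 * g) k]
    simpa using Nat.sub_dvd_pow_sub_pow (q ^ (2 * g)) 1 k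
  exact (Nat.mul_dvd_mul_right h1 _).trans (h2.dvd.trans h3)

omit [Fintype L] in
-- From `z^(q^g) = c / z` with `c` fixed by Frobenius, `z` is fixed by the `q^(2g)`-th power map, so
-- only the parity of `j` matters.
theorem pow_card_pow_add_one_eq {c : K} (hc : c ≠ 0) (hj : Odd j) {z : L}
    (hz : z ^ (Fintype.card K ^ g + 1) = algebraMap K L c) :
    z ^ (Fintype.card K ^ (g * j) + 1) = algebraMap K L c := by
  have hz0 : z ≠ 0 := by
    rintro rfl
    rw [zero_pow (Nat.succ_ne_zero _)] at hz
    exact hc ((map_eq_zero _).1 hz.symm)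
  have hsq : z ^ (Fintype.card K ^ g) ^ 2 = z := by
    have h1 : (z ^ (Fintype.card K ^ g + 1)) ^ Fintype.card K ^ g = algebraMap K L c := by
      rw [hz, ← map_pow, FiniteField.pow_card_pow]
    have h2 : z ^ (Fintype.card K ^ g) ^ 2 * z ^ Fintype.card K ^ g =
        z * z ^ Fintype.card K ^ g := by
      have h3 : z * z ^ Fintype.card K ^ g = algebraMap K L c := by rw [← hz, pow_succ']
      rw [h3, ← h1, ← pow_mul z, ← pow_add]
      congr 1
      ring
    exact mul_right_cancel₀ (pow_ne_zero _ hz0) h2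
  rw [pow_succ, pow_mul, pow_pow_of_pow_sq_eq_self hsq hj, ← pow_succ, hz]

omit [Fintype L] in
theorem powerTraceForm_mul {e : ℕ} {z : L} {c : K}
    (hz : z ^ (Fintype.card K ^ e + 1) = algebraMap K L c) (x : L) :
    powerTraceForm K L e (z * x) = c * powerTraceForm K L e x := by
  rw [powerTraceForm_apply, powerTraceForm_apply, mul_pow, hz, ← Algebra.smul_def, map_smul,
    smul_eq_mul]

/-- As `c^(q-1) = 1` and `(q-1)(q^g+1)` divides `|Lˣ|`, `c` is a `(q^g+1)`-th power `z^(q^g+1)`;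
multiplication by `z` maps the level set of 1 onto that of `c`. -/
theorem isBalanced_powerTraceForm (hj : Odd j)
    (hL : Fintype.card L = Fintype.card K ^ (2 * (g * k))) :
    IsBalanced (powerTraceForm K L (g * j)) := by
  intro c hc
  have hq : 1 < Fintype.card K := Fintype.one_lt_card
  obtain ⟨z, hz⟩ := exists_pow_eq_of_pow_eq_one (G := Lˣ) (r := Fintype.card K - 1)
    (s := Fintype.card K ^ g + 1) (c := Units.map (algebraMap K L) (Units.mk0 c hc)) (by omega)
    (by
      rw [Nat.card_units, Nat.card_eq_fintype_card, hL]
      exact card_sub_one_mul_dvd)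
    (by
      ext
      simp only [Units.val_pow_eq_pow_val, Units.coe_map, Units.val_mk0, MonoidHom.coe_coe,
        Units.val_one]
      rw [← map_pow, FiniteField.pow_card_sub_one_eq_one c hc, map_one])
  have hz' : (z : L) ^ (Fintype.card K ^ g + 1) = algebraMap K L c := by
    simpa using congrArg Units.val hz
  have hmul := powerTraceForm_mul (pow_card_pow_add_one_eq hc hj hz')
  symm
  refine Set.ncard_congr (fun x _ => (z : L) * x) ?_ ?_ ?_
  · intro x hx
    simp only [Set.mem_ofPred_eq] at hx ⊢
    rw [hmul, hx, mul_one]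
  · intro a b _ _ h
    exact mul_left_cancel₀ z.ne_zero h
  · intro y hy
    refine ⟨(z⁻¹ : Lˣ) * y, ?_, by simp⟩
    simp only [Set.mem_ofPred_eq] at hy ⊢
    apply mul_left_cancel₀ hc
    rw [← hmul, Units.mul_inv_cancel_left, hy, mul_one]

/-- There are `q^g + 1` roots of unity of this order in `L`, and multiplication by them preserves
the form. This divisibility later fixes the sign of the Gauss value. -/
theorem card_pow_add_one_dvd_ncard (hj : Odd j)
    (hL : Fintype.card L = Fintype.card K ^ (2 * (g * k))) :
    Fintype.card K ^ g + 1 ∣ Set.ncard {x | powerTraceForm K L (g * j) x = 1} := by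
  have hset : {x | powerTraceForm K L (g * j) x = 1} =
      Units.val '' {x : Lˣ | powerTraceForm K L (g * j) (x : L) = 1} := by
    ext x
    constructor
    · intro hx
      have hx0 : x ≠ 0 := by
        rintro rfl
        simp at hx
      exact ⟨Units.mk0 x hx0, hx, rfl⟩
    · rintro ⟨y, hy, rfl⟩
      exact hy
  have hdvd : Fintype.card K ^ g + 1 ∣ Nat.card Lˣ := by
    rw [Nat.card_units, Nat.card_eq_fintype_card, hL]
    exact (Dvd.intro_left _ rfl).trans card_sub_one_mul_dvd
  have hker := IsCyclic.card_powMonoidHom_ker Lˣ (Fintype.card K ^ g + 1)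
  rw [Nat.gcd_eq_right hdvd] at hker
  rw [hset, Set.ncard_image_of_injective _ Units.val_injective]
  nth_rw 1 [← hker]
  refine card_dvd_ncard_of_forall_mul_mem _ fun z x hz hx => ?_
  have hz' : (z : L) ^ (Fintype.card K ^ g + 1) = algebraMap K L 1 := by
    simpa using congrArg Units.val hz
  rw [Units.val_mul, powerTraceForm_mul (pow_card_pow_add_one_eq one_ne_zero hj hz'), hx, mul_one]

theorem ncard_radical_powerTraceForm (hK : Odd (Fintype.card K)) (hj : Odd j)
    (hgcd : Nat.gcd (2 * (g * k)) (2 * (g * j)) = 2 * g)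
    (hL : Fintype.card L = Fintype.card K ^ (2 * (g * k))) :
    Set.ncard {r | (powerTraceForm K L (g * j)).polarBilin r = 0} =
      Fintype.card K ^ (2 * if Odd k then 0 else g) := by
  have h2 : (2 : L) ≠ 0 := by
    intro h
    have hodd : Odd (Fintype.card L) := hL ▸ hK.pow
    have h0 : ((Fintype.card L : ℕ) : L) = 0 := FiniteField.cast_card_eq_zero L
    obtain ⟨t, ht⟩ := hodd
    rw [ht] at h0
    push_cast at h0
    simp [h] at h0
  simp_rw [polarBilin_powerTraceForm_eq_zero_iff]
  split_ifs with hk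
  · rw [mul_zero, pow_zero, Set.ncard_eq_one]
    refine ⟨0, ?_⟩
    ext r
    simp only [Set.mem_ofPred_eq, Set.mem_singleton_iff]
    constructor
    · intro hr
      -- Iterating `r ↦ -r` an odd number `k` of times gives `-r`, but the total exponent is
      -- `|L|^j`, which fixes `r`.
      have h := pow_pow_of_pow_eq_neg hK.pow hr k
      rw [hk.neg_one_pow, ← pow_mul, show 2 * (g * j) * k = 2 * (g * k) * j by ring, pow_mul, ← hL,
        FiniteField.pow_card_pow] at h
      have h' : 2 * r = 0 := by linear_combination h
      exact (mul_eq_zero.1 h').resolve_left h2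
    · rintro rfl
      rw [neg_zero, zero_pow]
      exact (hK.pow.pos).ne'
  · rw [Nat.not_odd_iff_even] at hk
    obtain ⟨i, rfl⟩ := hk
    -- For `k` even, `2 (q^(2g) - 1)` divides `q^(4g) - 1` and hence `|Lˣ|`, so `-1` is a `(q^(2g) -
    -- 1)`-th power. Multiplication by `y` identifies the radical with the solutions of `x^(q^(2gj))
    -- = x`, of which there are `q^(2g)`.
    obtain ⟨y, hy⟩ := exists_pow_eq_of_pow_eq_one (G := Lˣ) (r := 2)
      (s := Fintype.card K ^ (2 * g) - 1) (c := -1) two_ne_zero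
      (by
        rw [Nat.card_units, Nat.card_eq_fintype_card, hL]
        have h1 : 2 ∣ Fintype.card K ^ (2 * g) + 1 := by
          have : Even (Fintype.card K ^ (2 * g) + 1) := hK.pow.add_one
          exact this.two_dvd
        have h3 : (Fintype.card K ^ (2 * g) + 1) * (Fintype.card K ^ (2 * g) - 1) =
            Fintype.card K ^ (2 * g * 2) - 1 := by
          rw [← Nat.sq_sub_sq, one_pow, ← pow_mul]
        refine (Nat.mul_dvd_mul_right h1 _).trans (h3.dvd.trans ?_)
        rw [show 2 * (g * (i + i)) = 2 * g * 2 * i by ring, pow_mul _ (2 * g * 2) i]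
        simpa using Nat.sub_dvd_pow_sub_pow (Fintype.card K ^ (2 * g * 2)) 1 i)
      (by simp)
    have hy' : (y : L) ^ Fintype.card K ^ (2 * g) = -y := by
      have h := congrArg Units.val hy
      simp only [Units.val_pow_eq_pow_val, Units.val_neg, Units.val_one] at h
      rw [← Nat.sub_add_cancel (hK.pow (n := 2 * g)).pos, pow_succ, h, neg_one_mul]
    have hye : (y : L) ^ Fintype.card K ^ (2 * (g * j)) = -y := by
      have h := pow_pow_of_pow_eq_neg hK.pow hy' j
      rwa [hj.neg_one_pow, neg_one_mul, ← pow_mul, mul_assoc] at h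
    rw [← hgcd, ← ncard_pow_eq_self hK.pos hL]
    symm
    refine Set.ncard_congr (fun x _ => (y : L) * x) ?_ ?_ ?_
    · intro x hx
      simp only [Set.mem_ofPred_eq] at hx ⊢
      rw [mul_pow, hye, hx, neg_mul]
    · intro a b _ _ h
      exact mul_left_cancel₀ y.ne_zero h
    · intro x hx
      refine ⟨(y⁻¹ : Lˣ) * x, ?_, by simp⟩
      simp only [Set.mem_ofPred_eq] at hx ⊢
      apply mul_left_cancel₀ y.ne_zero
      rw [Units.mul_inv_cancel_left, ← neg_inj, ← hx, ← neg_mul, ← hye, ← mul_pow,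
        Units.mul_inv_cancel_left]

theorem gaussValue_powerTraceForm (hK : Odd (Fintype.card K)) (hj : Odd j) (hg : 0 < g)
    (hgcd : Nat.gcd (2 * (g * k)) (2 * (g * j)) = 2 * g)
    (hL : Fintype.card L = Fintype.card K ^ (2 * (g * k))) :
    gaussValue (powerTraceForm K L (g * j)) =
      -(Fintype.card K : ℚ) ^ (g * k + if Odd k then 0 else g) := by
  have h2 : (2 : K) ≠ 0 := by
    intro h
    have h0 : ((Fintype.card K : ℕ) : K) = 0 := FiniteField.cast_card_eq_zero K
    obtain ⟨t, ht⟩ := hK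
    rw [ht] at h0
    push_cast at h0
    simp [h] at h0
  have hbal := isBalanced_powerTraceForm hj hL
  have hsq := gaussValue_sq h2 hbal
  rw [ncard_radical_powerTraceForm hK hj hgcd hL, hL] at hsq
  have hsq' : gaussValue (powerTraceForm K L (g * j)) ^ 2 =
      ((Fintype.card K : ℚ) ^ (g * k + if Odd k then 0 else g)) ^ 2 := by
    rw [hsq]
    push_cast
    rw [← pow_add, ← pow_mul]
    congr 1
    ring
  rcases sq_eq_sq_iff_eq_or_eq_neg.1 hsq' with h | h
  · exfalso
    have hones := card_mul_ncard_ones hbal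
    obtain ⟨t, ht⟩ := card_pow_add_one_dvd_ncard hj hL
    rw [h, hL, ht] at hones
    -- In both parities of `k` the exponent is an odd multiple of `g`, so with `X = q^g` a positive
    -- Gauss value would be `X^n ≡ -1` modulo `X + 1`.
    obtain ⟨n, hn, hn'⟩ : ∃ n, Odd n ∧ (g * k + if Odd k then 0 else g) = g * n := by
      split_ifs with hk
      · exact ⟨k, hk, rfl⟩
      · exact ⟨k + 1, (Nat.not_odd_iff_even.1 hk).add_one, by ring⟩
    rw [hn', show 2 * (g * k) = g * (2 * k) by ring] at hones
    have hZ : (Fintype.card K : ℤ) * ((Fintype.card K ^ g + 1) * t) =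
        (Fintype.card K ^ g) ^ (2 * k) - (Fintype.card K ^ g) ^ n := by
      rw [← pow_mul, ← pow_mul]
      exact_mod_cast hones
    have hX : 3 ≤ (Fintype.card K : ℤ) ^ g := by
      have h3 : 3 ≤ Fintype.card K := by
        have := Fintype.one_lt_card (α := K)
        obtain ⟨s, hs⟩ := hK
        omega
      have : Fintype.card K ≤ Fintype.card K ^ g := Nat.le_self_pow hg.ne' _
      exact_mod_cast h3.trans this
    set X := (Fintype.card K : ℤ) ^ g
    have d1 : X + 1 ∣ X ^ (2 * k) - 1 := by
      have h1 : X + 1 ∣ X ^ 2 - 1 := ⟨X - 1, by ring⟩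
      refine h1.trans ?_
      rw [pow_mul]
      simpa using sub_dvd_pow_sub_pow (X ^ 2) 1 k
    have d2 : X + 1 ∣ X ^ n + 1 := by
      simpa using hn.add_dvd_pow_add_pow X 1
    have d3 : X + 1 ∣ X ^ (2 * k) - X ^ n := hZ ▸ ⟨Fintype.card K * t, by ring⟩
    -- Modulo `X + 1` the difference `X^(2k) - X^n` is `1 + 1`, yet it is divisible by `X + 1 ≥ 4`.
    have d4 : X + 1 ∣ 2 := by
      have := (d3.sub d1).add d2
      rwa [show X ^ (2 * k) - X ^ n - (X ^ (2 * k) - 1) + (X ^ n + 1) = 2 by ring] at this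
    have := Int.le_of_dvd (by norm_num) d4
    omega
  · exact h

end TraceForm

/-! ### Distinctness of weights, nonzero frequencies, length -/

section EvaluationCode

open Finset Module

theorem injective_of_chain_seven {v : Fin 7 → ℚ} (h01 : v 0 < v 1) (h15 : v 1 < v 5)
    (h54 : v 5 < v 4) (h46 : v 4 < v 6) (h63 : v 6 < v 3) (h32 : v 3 < v 2) :
    Function.Injective v ∧ ∀ i, i ≠ 0 → v 1 ≤ v i := by
  constructor
  · intro i j h
    fin_cases i <;> fin_cases j <;> first
      | rfl
      | (exfalso; simp only [Fin.zero_eta, Fin.mk_one, Fin.reduceFinMk] at h; linarith)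
  · intro i hi
    fin_cases i <;> simp only [Fin.zero_eta, Fin.mk_one, Fin.reduceFinMk] at hi ⊢ <;> first
      | exact absurd rfl hi
      | linarith

theorem injective_of_chain_five {v : Fin 5 → ℚ} (h01 : v 0 < v 1) (h13 : v 1 < v 3)
    (h34 : v 3 < v 4) (h42 : v 4 < v 2) :
    Function.Injective v ∧ ∀ i, i ≠ 0 → v 1 ≤ v i := by
  constructor
  · intro i j h
    fin_cases i <;> fin_cases j <;> first
      | rfl
      | (exfalso; simp only [Fin.zero_eta, Fin.mk_one, Fin.reduceFinMk] at h; linarith)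
  · intro i hi
    fin_cases i <;> simp only [Fin.zero_eta, Fin.mk_one, Fin.reduceFinMk] at hi ⊢ <;> first
      | exact absurd rfl hi
      | linarith

/-- The increasing order of the indices is 0, 1, 5, 4, 6, 3, 2. The strict bound `q Y < N` is what
makes the smallest nonzero weight positive. -/
theorem anisotropicWeight_injective {q N Y : ℚ} (hq : 3 ≤ q) (hY : 0 < Y) (hN : q * Y < N) :
    Function.Injective (anisotropicWeight q N (-Y)) ∧
      ∀ i, i ≠ 0 → anisotropicWeight q N (-Y) 1 ≤ anisotropicWeight q N (-Y) i := by
  have hq0 : 0 < q := by linarith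
  have hq1 : 0 < q - 1 := by linarith
  have hNpos : 0 < N := lt_trans (by positivity) hN
  have hstep : 0 < (q - 1) * Y / q ^ 2 := by positivity
  have hbig : 0 < (q - 1) * (N - q * Y) / q ^ 2 := by
    have : 0 < N - q * Y := by linarith
    positivity
  have hgap : 0 < (q - 1) * ((q - 1) * N - q * Y) / q ^ 3 := by
    have : 0 < (q - 1) * N - q * Y := by nlinarith
    positivity
  have hmul : 0 < (q - 1) * (q - 2) * Y / q ^ 2 := by
    have : 0 < q - 2 := by linarith
    positivity
  refine injective_of_chain_seven ?_ ?_ ?_ ?_ ?_ ?_ <;>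
    simp only [anisotropicWeight, Matrix.cons_val] <;> rw [← sub_pos]
  · convert hbig using 1; field_simp; ring
  · convert hgap using 1; field_simp; ring
  · convert hstep using 1; field_simp; ring
  · convert hstep using 1; field_simp; ring
  · convert hmul using 1; field_simp; ring
  · convert hstep using 1; field_simp; ring

/-- The increasing order of the indices is 0, 1, 3, 4, 2. The weight at index 1 does not involve
`Y`, so the weak bound suffices. -/
theorem isotropicWeight_injective {q N Y : ℚ} (hq : 3 ≤ q) (hY : 0 < Y) (hN : q * Y ≤ N) :
    Function.Injective (isotropicWeight q N (-Y)) ∧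
      ∀ i, i ≠ 0 → isotropicWeight q N (-Y) 1 ≤ isotropicWeight q N (-Y) i := by
  have hq0 : 0 < q := by linarith
  have hq1 : 0 < q - 1 := by linarith
  have hNpos : 0 < N := lt_of_lt_of_le (by positivity) hN
  have hstep : 0 < (q - 1) * Y / q ^ 2 := by positivity
  have hstep' : 0 < (q - 1) ^ 2 * Y / q ^ 2 := by positivity
  have hbig : 0 < (q - 1) * N / q ^ 2 := by positivity
  have hgap : 0 < (q - 1) * ((q - 1) * N - q * Y) / q ^ 3 := by
    have : 0 < (q - 1) * N - q * Y := by nlinarith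
    positivity
  refine injective_of_chain_five ?_ ?_ ?_ ?_ <;>
    simp only [isotropicWeight, Matrix.cons_val] <;> rw [← sub_pos]
  · convert hbig using 1; field_simp; ring
  · convert hgap using 1; field_simp; ring
  · convert hstep using 1; field_simp; ring
  · convert hstep' using 1; field_simp; ring

/-- The bound `q^2 r < N`, which amounts to `m > 2ε + 2`, is exactly what makes the classes 2 and 4
nonempty. -/
theorem anisotropicFreq_ne_zero {q N Y r : ℚ} (hq : 3 ≤ q) (hY : 0 < Y) (hN : q * Y < N)
    (hr : 1 ≤ r) (hNr : q ^ 2 * r < N) (i : Fin 7) : anisotropicFreq q N (-Y) r i ≠ 0 := by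
  have hq0 : 0 < q := by linarith
  have hq1 : 0 < q - 1 := by linarith
  have hq2 : 0 < q - 2 := by linarith
  have hr0 : 0 < r := by linarith
  have hNpos : 0 < N := lt_trans (by positivity) hN
  have h1 : 0 < N / (q ^ 2 * r) - 1 := by
    rw [sub_pos, one_lt_div (by positivity)]
    exact hNr
  have h2 : 0 < (q - 1) * (N + q * -Y) / (q ^ 2 * r) := by
    have : 0 < N + q * -Y := by linarith
    positivity
  apply ne_of_gt
  fin_cases i <;> simp only [anisotropicFreq, Fin.zero_eta, Fin.mk_one, Fin.reduceFinMk,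
    Matrix.cons_val]
  · norm_num
  · exact hq1
  · exact h1
  · exact h2
  · positivity
  · positivity
  · have h3 : 0 < (2 * q * N * (r - 1) + (q - 1) * N + q * (q - 1) * Y) / (2 * q * r) := by
      have : 0 ≤ r - 1 := by linarith
      positivity
    refine h3.trans_eq ?_
    field_simp
    ring

theorem isotropicFreq_ne_zero {q N r : ℚ} (hq : 3 ≤ q) (hr : 1 ≤ r) (hN : q ^ 2 < N)
    (i : Fin 5) : isotropicFreq q N r i ≠ 0 := by
  have hq0 : 0 < q := by linarith
  have hq1 : 0 < q - 1 := by linarith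
  have hr0 : 0 < r := by linarith
  have hNpos : 0 < N := lt_trans (by positivity) hN
  apply ne_of_gt
  fin_cases i <;> simp only [isotropicFreq, Fin.zero_eta, Fin.mk_one, Fin.reduceFinMk,
    Matrix.cons_val]
  · norm_num
  · exact hq1
  · positivity
  · positivity
  · have h3 : 0 < ((r - 1) * (q * (N - q)) + (N - q ^ 2)) / (q * r) := by
      have h1 : 0 ≤ r - 1 := by linarith
      have h2 : 0 < N - q ^ 2 := by linarith
      have h3 : 0 < N - q := by nlinarith
      positivity
    refine h3.trans_eq ?_
    field_simp
    ring

variable {K V : Type*} [Field K] [AddCommGroup V] [Module K V]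

/-- The encoder of functionals by their values at the points `d`. -/
def evalEncode (K : Type*) {V : Type*} [Field K] [AddCommGroup V] [Module K V] {n : ℕ}
    (d : Fin n → V) : Dual K V →ₗ[K] (Fin n → K) :=
  LinearMap.pi fun i => LinearMap.applyₗ (d i)

variable {n : ℕ} {d : Fin n → V}

/-- Leaving 0 out of the defining set loses nothing, because `g 0 = 0`. -/
theorem hammingNorm_evalEncode [DecidableEq K] {Q : QuadraticForm K V} {f : Dual K V}
    (hd : Function.Injective d) (hD : Set.range d = {x | x ≠ 0 ∧ (Q x = 0 ∨ f x = 0)})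
    (g : Dual K V) : hammingNorm (evalEncode K d g) = unionWeight Q f g := by
  have himg : {x | (Q x = 0 ∨ f x = 0) ∧ g x ≠ 0} = d '' {i | g (d i) ≠ 0} := by
    ext x
    constructor
    · rintro ⟨h1, h2⟩
      have hx : x ∈ Set.range d := by
        rw [hD]
        exact ⟨by rintro rfl; simp at h2, h1⟩
      obtain ⟨i, rfl⟩ := hx
      exact ⟨i, h2, rfl⟩
    · rintro ⟨i, hi, rfl⟩
      have hx : d i ∈ Set.range d := ⟨i, rfl⟩
      rw [hD] at hx
      exact ⟨hx.2, hi⟩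
  rw [unionWeight, himg, Set.ncard_image_of_injective _ hd, Set.ncard_eq_toFinset_card',
    Set.toFinset_ofPred]
  rfl

variable [Fintype K] [Fintype V]

theorem length_evalEncode (h2 : (2 : K) ≠ 0) {Q : QuadraticForm K V} (hQ : IsBalanced Q)
    {f : Dual K V} (hf : f ≠ 0) (hd : Function.Injective d)
    (hD : Set.range d = {x | x ≠ 0 ∧ (Q x = 0 ∨ f x = 0)}) :
    (Fintype.card K : ℚ) ^ 2 * (n + 1) = (2 * Fintype.card K - 1) * Fintype.card V +
      gaussValue Q * (Fintype.card K * (Fintype.card K - 1) - lineSign Q f) := by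
  classical
  -- The extra 1 is the vector 0, which satisfies both equations but is excluded from the defining
  -- set.
  have hn : (n : ℚ) + 1 = Set.ncard {x | Q x = 0 ∨ f x = 0} := by
    have h1 : Set.ncard (Set.range d) = n := by
      rw [Set.ncard_range_of_injective hd]
      simp
    have h3 : {x | Q x = 0 ∨ f x = 0} = insert 0 (Set.range d) := by
      rw [hD]
      ext x
      simp only [Set.mem_ofPred_eq, Set.mem_insert_iff]
      by_cases hx : x = 0 <;> simp [hx]
    rw [h3, Set.ncard_insert_of_notMem, h1]
    · push_cast
      rfl
    · rw [hD]
      exact fun h => h.1 rfl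
  have hunion : (Set.ncard {x | Q x = 0 ∨ f x = 0} : ℚ) = Set.ncard {x | Q x = 0} +
      Set.ncard {x | f x = 0} - Set.ncard {x | Q x = 0 ∧ f x = 0} := by
    simp_rw [ncard_setOf_eq_sum, ← Finset.sum_add_distrib, ← Finset.sum_sub_distrib]
    refine Finset.sum_congr rfl fun x _ => ?_
    by_cases h1 : Q x = 0 <;> by_cases h2 : f x = 0 <;> simp [h1, h2]
  rw [hn, hunion]
  linear_combination (Fintype.card K : ℚ) * card_mul_ncard_zeros_univ hQ +
    (Fintype.card K : ℚ) * card_mul_ncard_dual_eq_zero hf - card_mul_ncard_zeros_dual h2 hQ hf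

omit [Fintype K] in
theorem one_le_ncard_radical (Q : QuadraticForm K V) :
    (1 : ℚ) ≤ Set.ncard {r | Q.polarBilin r = 0} := by
  have h := ncard_radical_ne_zero Q
  rw [Nat.cast_ne_zero] at h
  exact_mod_cast Nat.one_le_iff_ne_zero.2 h

theorem anisotropic_evalEncode [DecidableEq K] (h2 : (2 : K) ≠ 0) {Q : QuadraticForm K V}
    (hQ : IsBalanced Q) {u : V} (hu : Q u ≠ 0) (hd : Function.Injective d)
    (hD : Set.range d = {x | x ≠ 0 ∧ (Q x = 0 ∨ Q.polarBilin u x = 0)})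
    {q N Y r : ℚ} (hq : (Fintype.card K : ℚ) = q) (hN : (Fintype.card V : ℚ) = N)
    (hG : gaussValue Q = -Y) (hr : (Set.ncard {r | Q.polarBilin r = 0} : ℚ) = r)
    (hq3 : 3 ≤ q) (hY : 0 < Y) (hYN : q * Y < N) (hNr : q ^ 2 * r < N) :
    q ^ 2 * (n + 1) = (2 * q - 1) * N - Y * (q * (q - 1)) ∧
    IsTWeight (LinearMap.range (evalEncode K d)) 6 ∧
    Module.finrank K (LinearMap.range (evalEncode K d)) = Module.finrank K V ∧
    IsMinDistance (LinearMap.range (evalEncode K d)) (anisotropicWeight q N (-Y) 1) ∧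
    HasWeightDistribution (LinearMap.range (evalEncode K d))
      (List.ofFn fun i => (anisotropicWeight q N (-Y) i, anisotropicFreq q N (-Y) r i)) := by
  have hr1 := one_le_ncard_radical Q
  obtain ⟨hinj, hmin⟩ := anisotropicWeight_injective hq3 hY hYN
  have hfin : Finite (Dual K V) := Module.finite_of_finite K
  constructor
  · have h := length_evalEncode h2 hQ (polarBilin_ne_zero_of_ne_zero h2 Q hu) hd hD
    rw [lineSign_polarBilin h2, if_neg hu, hq, hN, hG] at h
    linear_combination h
  · rw [← Subspace.dual_finrank_eq (K := K) (V := V)]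
    refine code_of_weights (evalEncode K d) hinj rfl (fun g => ?_) (fun i => ?_) rfl
      (anisotropicFreq_ne_zero hq3 hY hYN (hr ▸ hr1) hNr) hmin
    · obtain ⟨i, hi⟩ := exists_anisotropicClass h2 Q hu g
      refine ⟨i, ?_⟩
      rw [hammingNorm_evalEncode hd hD, unionWeight_of_anisotropicClass h2 hQ hu i g hi, hq, hN, hG]
    · simp_rw [hammingNorm_evalEncode hd hD]
      have h := ncard_anisotropic_weight h2 hQ hu (by rwa [hq, hN, hG]) i
      rwa [hq, hN, hG, hr] at h

theorem isotropic_evalEncode [DecidableEq K] (h2 : (2 : K) ≠ 0) {Q : QuadraticForm K V}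
    (hQ : IsBalanced Q) {u : V} (hu : Q u = 0) (hf : Q.polarBilin u ≠ 0)
    (hd : Function.Injective d)
    (hD : Set.range d = {x | x ≠ 0 ∧ (Q x = 0 ∨ Q.polarBilin u x = 0)})
    {q N Y r : ℚ} (hq : (Fintype.card K : ℚ) = q) (hN : (Fintype.card V : ℚ) = N)
    (hG : gaussValue Q = -Y) (hr : (Set.ncard {r | Q.polarBilin r = 0} : ℚ) = r)
    (hq3 : 3 ≤ q) (hY : 0 < Y) (hYN : q * Y ≤ N) (hNq : q ^ 2 < N) :
    q ^ 2 * (n + 1) = (2 * q - 1) * N ∧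
    IsTWeight (LinearMap.range (evalEncode K d)) 4 ∧
    Module.finrank K (LinearMap.range (evalEncode K d)) = Module.finrank K V ∧
    IsMinDistance (LinearMap.range (evalEncode K d)) (isotropicWeight q N (-Y) 1) ∧
    HasWeightDistribution (LinearMap.range (evalEncode K d))
      (List.ofFn fun i => (isotropicWeight q N (-Y) i, isotropicFreq q N r i)) := by
  have hr1 := one_le_ncard_radical Q
  obtain ⟨hinj, hmin⟩ := isotropicWeight_injective hq3 hY hYN
  have hfin : Finite (Dual K V) := Module.finite_of_finite K
  constructor
  · have h := length_evalEncode h2 hQ hf hd hD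
    rw [lineSign_polarBilin h2, if_pos hu, hq, hN, hG] at h
    linear_combination h
  · rw [← Subspace.dual_finrank_eq (K := K) (V := V)]
    refine code_of_weights (evalEncode K d) hinj rfl (fun g => ?_) (fun i => ?_) rfl
      (isotropicFreq_ne_zero hq3 (hr ▸ hr1) hNq) hmin
    · obtain ⟨i, hi⟩ := exists_isotropicClass Q u g
      refine ⟨i, ?_⟩
      rw [hammingNorm_evalEncode hd hD, unionWeight_of_isotropicClass h2 hQ hu hf i g hi, hq, hN,
        hG]
    · simp_rw [hammingNorm_evalEncode hd hD]
      have h := ncard_isotropic_weight h2 hQ hu hf (by rwa [hq, hN, hG]) i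
      rwa [hq, hN, hG, hr] at h

end EvaluationCode

/-! ### The code of the theorem -/

section PowerTraceCode

open Finset Module

/-- With `g = gcd(m, e)`, `m / g = 2k` is coprime to `j = e / g`; so `j` is odd, and coprime to `k`.
-/
theorem exists_factorization_of_even_div_gcd {m e : ℕ} (hm : 0 < m)
    (heven : Even (m / Nat.gcd m e)) :
    ∃ g k j, 0 < g ∧ 0 < k ∧ Odd j ∧ m = 2 * (g * k) ∧ e = g * j ∧
      Nat.gcd (2 * (g * k)) (2 * (g * j)) = 2 * g ∧
      epsilon m e = if Odd k then 0 else g := by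
  obtain ⟨k, hk⟩ := heven
  have hg : 0 < Nat.gcd m e := Nat.gcd_pos_of_pos_left _ hm
  have hmg : m = Nat.gcd m e * (k + k) := by
    rw [← hk, Nat.mul_div_cancel' (Nat.gcd_dvd_left m e)]
  obtain ⟨j, hj⟩ := Nat.gcd_dvd_right m e
  have hcop : Nat.Coprime (k + k) j := by
    have h1 : Nat.gcd m e * 1 = Nat.gcd m e * Nat.gcd (k + k) j := by
      rw [← Nat.gcd_mul_left, ← hmg, ← hj, mul_one]
    exact (Nat.eq_of_mul_eq_mul_left hg h1).symm
  have hm2 : m = 2 * (Nat.gcd m e * k) := by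
    rw [mul_left_comm, two_mul]
    exact hmg
  refine ⟨Nat.gcd m e, k, j, hg, ?_, ?_, hm2, hj, ?_, ?_⟩
  · rcases Nat.eq_zero_or_pos k with rfl | h
    · omega
    · exact h
  · rw [← Nat.not_even_iff_odd]
    intro hev
    have h2 : 2 ∣ Nat.gcd (k + k) j := Nat.dvd_gcd ⟨k, by ring⟩ hev.two_dvd
    rw [hcop] at h2
    omega
  · rw [Nat.gcd_mul_left, Nat.gcd_mul_left, (hcop.coprime_dvd_left ⟨2, by ring⟩ : Nat.gcd k j = 1),
      mul_one]
  · have hdiv : m / 2 / Nat.gcd m e = k := by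
      nth_rw 1 [hm2]
      rw [Nat.mul_div_cancel_left _ two_pos, Nat.mul_div_cancel_left _ hg]
    rw [epsilon, hdiv]

/-- Nondegeneracy of the trace form makes `b ↦ Tr(b ·)` an isomorphism from `L` to its dual. -/
theorem traceCode_eq_range_evalEncode {K L : Type*} [Field K] [Fintype K] [Field L] [Algebra K L]
    [FiniteDimensional K L] {n : ℕ} (d : Fin n → L) :
    traceCode K d = LinearMap.range (evalEncode K d) := by
  have hcomp : traceEncode K d = (evalEncode K d).comp
      ((Algebra.traceForm K L).toDual (traceForm_nondegenerate K L)).toLinearMap := by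
    ext b i
    simp [traceEncode, evalEncode, LinearMap.BilinForm.toDual_def, Algebra.traceForm_apply]
  rw [traceCode, hcomp, LinearMap.range_comp_of_range_eq_top _ (LinearEquiv.range _)]

theorem setD3_zero_zero {K L : Type*} [Field K] [Fintype K] [Field L] [Fintype L] [Algebra K L]
    (h2 : (2 : K) ≠ 0) (e : ℕ) :
    setD3 K L e 0 0 = {x | x ≠ 0 ∧ (powerTraceForm K L e x = 0 ∨
      (powerTraceForm K L e).polarBilin (algebraMap K L 2⁻¹) x = 0)} := by
  ext x
  simp only [setD3, setE1, setE2, Set.mem_union, Set.mem_ofPred_eq, powerTraceForm_apply,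
    polarBilin_powerTraceForm_algebraMap h2, Nat.card_eq_fintype_card]
  tauto

theorem pow_eq_div {q : ℚ} (hq : q ≠ 0) {s a b : ℕ} (h : s + b = a) : q ^ s = q ^ a / q ^ b := by
  rw [eq_div_iff (pow_ne_zero _ hq), ← pow_add, h]

end PowerTraceCode

/- `K` is the field with `q` elements and `L` the field with `q ^ m` elements. The subtractions
in the exponents never truncate under the hypotheses (`ε = 0` or `2 * ε ≤ ℓ`). -/
theorem theorem5 {K L : Type*} [Field K] [Fintype K] [DecidableEq K] [Field L] [Algebra K L]
    (p q m ℓ e ε : ℕ) [Fact p.Prime] [CharP K p] (hp : p ≠ 2)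
    (hq : Fintype.card K = q) (hm : Module.finrank K L = m) (hℓ : m = 2 * ℓ)
    (he : 0 < e) (heven : Even (m / Nat.gcd m e)) (hε : ε = epsilon m e)
    (hm3 : 3 < m) (hmε : (m : ZMod p) ≠ 0 → 2 * ε + 2 < m)
    (n : ℕ) (d : Fin n → L) (hd : Function.Injective d)
    (hD : Set.range d = setD3 K L e 0 0) :
    ((m : ZMod p) ≠ 0 →
      IsTWeight (traceCode K d) 6 ∧
      (n : ℚ) = ((q : ℚ) - 1) * ((q : ℚ) ^ (m - 2) - (q : ℚ) ^ (ℓ + ε - 1))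
        + (q : ℚ) ^ (m - 1) - 1 ∧
      Module.finrank K (traceCode K d) = m ∧
      IsMinDistance (traceCode K d)
        (((q : ℚ) - 1) * ((q : ℚ) ^ (m - 2) - (q : ℚ) ^ (ℓ + ε - 1))) ∧
      HasWeightDistribution (traceCode K d)
        [(0, 1),
         (((q : ℚ) - 1) * ((q : ℚ) ^ (m - 2) - (q : ℚ) ^ (ℓ + ε - 1)),
          (q : ℚ) - 1),
         (((q : ℚ) - 1) * (2 * (q : ℚ) ^ (m - 2) - (q : ℚ) ^ (m - 3)),
          (q : ℚ) ^ (m - 2 * ε - 2) - 1),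
         (((q : ℚ) - 1) * (2 * (q : ℚ) ^ (m - 2) - (q : ℚ) ^ (m - 3) - (q : ℚ) ^ (ℓ + ε - 2)),
          ((q : ℚ) - 1) * ((q : ℚ) ^ (m - 2 * ε - 2) - (q : ℚ) ^ (ℓ - ε - 1))),
         (((q : ℚ) - 1) * (2 * (q : ℚ) ^ (m - 2) - (q : ℚ) ^ (m - 3) - (q : ℚ) ^ (ℓ + ε - 1)),
          ((q : ℚ) - 1) * ((q : ℚ) ^ (m - 2 * ε - 2) - 1)),
         (((q : ℚ) - 1) * (2 * (q : ℚ) ^ (m - 2) - (q : ℚ) ^ (m - 3) - (q : ℚ) ^ (ℓ + ε - 1)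
            - (q : ℚ) ^ (ℓ + ε - 2)),
          ((q : ℚ) - 1) / 2 * ((q : ℚ) ^ (m - 2 * ε - 1) - (q : ℚ) ^ (ℓ - ε)
            + 2 * (q : ℚ) ^ (ℓ - ε - 1) - 2 * (q : ℚ) ^ (m - 2 * ε - 2))),
         (((q : ℚ) - 1) * (2 * (q : ℚ) ^ (m - 2) - (q : ℚ) ^ (m - 3) - (q : ℚ) ^ (ℓ + ε - 1)
            + (q : ℚ) ^ (ℓ + ε - 2)),
          (q : ℚ) ^ m + 1 / 2 * ((q : ℚ) ^ (ℓ - ε + 1) - (q : ℚ) ^ (m - 2 * ε)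
            - (q : ℚ) ^ (m - 2 * ε - 1) - (q : ℚ) ^ (ℓ - ε)))]) ∧
    ((m : ZMod p) = 0 →
      IsTWeight (traceCode K d) 4 ∧
      (n : ℚ) = ((q : ℚ) - 1) * (q : ℚ) ^ (m - 2) + (q : ℚ) ^ (m - 1) - 1 ∧
      Module.finrank K (traceCode K d) = m ∧
      IsMinDistance (traceCode K d) (((q : ℚ) - 1) * (q : ℚ) ^ (m - 2)) ∧
      HasWeightDistribution (traceCode K d)
        [(0, 1),
         (((q : ℚ) - 1) * (q : ℚ) ^ (m - 2),
          (q : ℚ) - 1),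
         (((q : ℚ) - 1) * (2 * (q : ℚ) ^ (m - 2) - (q : ℚ) ^ (m - 3) + (q : ℚ) ^ (ℓ + ε - 1)
            - (q : ℚ) ^ (ℓ + ε - 2)),
          ((q : ℚ) - 1) * (q : ℚ) ^ (m - 2 * ε - 2)),
         (((q : ℚ) - 1) * (2 * (q : ℚ) ^ (m - 2) - (q : ℚ) ^ (m - 3) - (q : ℚ) ^ (ℓ + ε - 2)),
          ((q : ℚ) - 1) ^ 2 * (q : ℚ) ^ (m - 2 * ε - 2)),
         (((q : ℚ) - 1) * (2 * (q : ℚ) ^ (m - 2) - (q : ℚ) ^ (m - 3)),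
          (q : ℚ) ^ m - (q : ℚ) ^ (m - 2 * ε) + (q : ℚ) ^ (m - 2 * ε - 1) - (q : ℚ))]) := by
  have hKodd : Odd (Fintype.card K) := by
    obtain ⟨t, hpp, ht⟩ := FiniteField.card K p
    rw [ht]
    exact (hpp.odd_of_ne_two hp).pow
  have hK3 : 3 ≤ Fintype.card K := by
    have := Fintype.one_lt_card (α := K)
    obtain ⟨s, hs⟩ := hKodd
    omega
  have h2 : (2 : K) ≠ 0 := by
    have := Ring.two_ne_zero (R := K) (by rwa [ringChar.eq K p])
    exact this
  have hfd : FiniteDimensional K L := FiniteDimensional.of_finrank_pos (by omega)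
  have hLfin : Finite L := Module.finite_of_finite K
  have := Fintype.ofFinite L
  have hcast : (m : ZMod p) = 0 ↔ (m : K) = 0 := by
    rw [CharP.cast_eq_zero_iff (ZMod p) p, CharP.cast_eq_zero_iff K p]
  obtain ⟨g, k, j, hg, hk, hj, hmgk, rfl, hgcd, heps⟩ :=
    exists_factorization_of_even_div_gcd (by omega) heven
  have hℓgk : ℓ = g * k := by omega
  rw [← hε] at heps
  -- If `ε` is not 0 then `ε = g` and `k` is even, so `k ≥ 2`.
  have hεℓ : 2 * ε ≤ ℓ := by
    rw [heps, hℓgk]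
    split_ifs with hodd
    · omega
    · rw [mul_comm]
      refine Nat.mul_le_mul_left g ?_
      by_contra h
      obtain rfl : k = 1 := by omega
      exact hodd odd_one
  have hL : Fintype.card L = Fintype.card K ^ (2 * (g * k)) := by
    rw [Module.card_eq_pow_finrank (K := K), hm, hmgk]
  have hbal := isBalanced_powerTraceForm hj hL
  have hrad := ncard_radical_powerTraceForm hKodd hj hgcd hL
  have hgauss := gaussValue_powerTraceForm hKodd hj hg hgcd hL
  rw [← heps] at hrad hgauss
  rw [← hℓgk] at hgauss
  rw [hq] at hgauss hrad hK3
  have hradQ : (Set.ncard {r | (powerTraceForm K L (g * j)).polarBilin r = 0} : ℚ) =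
      (q : ℚ) ^ (2 * ε) := by
    rw [hrad]
    push_cast
    rfl
  have hLQ : (Fintype.card L : ℚ) = (q : ℚ) ^ (2 * ℓ) := by
    rw [hL, hq, hℓgk]
    push_cast
    rfl
  have hqQ : (Fintype.card K : ℚ) = (q : ℚ) := by rw [hq]
  have hq3 : (3 : ℚ) ≤ q := by exact_mod_cast hK3
  have hq0 : (q : ℚ) ≠ 0 := by positivity
  have hq1 : (1 : ℚ) < q := by linarith
  have hY : (0 : ℚ) < (q : ℚ) ^ (ℓ + ε) := by positivity
  rw [setD3_zero_zero h2] at hD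
  rw [traceCode_eq_range_evalEncode, ← hm]
  have hQu := powerTraceForm_algebraMap (K := K) (L := L) (g * j)
  have h4 : (2⁻¹ * 2⁻¹ : K) ≠ 0 := mul_ne_zero (inv_ne_zero h2) (inv_ne_zero h2)
  rw [hm]
  -- All powers are expressed through `N = q^(2ℓ)`, `Y = q^(ℓ+ε)` and `r = q^(2ε)`, so that the
  -- tables become rational identities in `q, N, Y, r`.
  have e1 : (q : ℚ) ^ (m - 2) = q ^ (2 * ℓ) / q ^ 2 := pow_eq_div hq0 (by omega)
  have e2 : (q : ℚ) ^ (m - 3) = q ^ (2 * ℓ) / q ^ 3 := pow_eq_div hq0 (by omega)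
  have e3 : (q : ℚ) ^ (ℓ + ε - 1) = q ^ (ℓ + ε) / q ^ 1 := pow_eq_div hq0 (by omega)
  have e4 : (q : ℚ) ^ (ℓ + ε - 2) = q ^ (ℓ + ε) / q ^ 2 := pow_eq_div hq0 (by omega)
  have e5 : (q : ℚ) ^ (m - 1) = q ^ (2 * ℓ) / q ^ 1 := pow_eq_div hq0 (by omega)
  have e6 : (q : ℚ) ^ (m - 2 * ε) = q ^ (2 * ℓ) / q ^ (2 * ε) := pow_eq_div hq0 (by omega)
  have e7 : (q : ℚ) ^ (m - 2 * ε - 1) = q ^ (2 * ℓ) / q ^ (2 * ε + 1) := pow_eq_div hq0 (by omega)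
  have e8 : (q : ℚ) ^ (m - 2 * ε - 2) = q ^ (2 * ℓ) / q ^ (2 * ε + 2) := pow_eq_div hq0 (by omega)
  have e9 : (q : ℚ) ^ (ℓ - ε) = q ^ (ℓ + ε) / q ^ (2 * ε) := pow_eq_div hq0 (by omega)
  have e10 : (q : ℚ) ^ m = q ^ (2 * ℓ) := by rw [hℓ]
  have hε1 : ε + 1 ≤ ℓ := by omega
  have e11 : (q : ℚ) ^ (ℓ - ε - 1) = q ^ (ℓ + ε) / q ^ (2 * ε + 1) := pow_eq_div hq0 (by omega)
  rw [e1, e2, e3, e4, e5, e6, e7, e8, pow_succ _ (ℓ - ε), e9, e10, e11, pow_succ _ (2 * ε + 1),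
    pow_succ _ (2 * ε)]
  have hr0 : (0 : ℚ) < (q : ℚ) ^ (2 * ε) := by positivity
  constructor
  · intro hm0
    have hε2 := hmε hm0
    have hu : powerTraceForm K L (g * j) (algebraMap K L 2⁻¹) ≠ 0 := by
      rw [hQu, hm]
      exact mul_ne_zero (fun h => hm0 (hcast.2 h)) h4
    have hYN : (q : ℚ) * q ^ (ℓ + ε) < q ^ (2 * ℓ) := by
      rw [← pow_succ']
      exact pow_lt_pow_right₀ hq1 (by omega)
    -- This is where `m > 2ε + 2` enters.
    have hNr : (q : ℚ) ^ 2 * q ^ (2 * ε) < q ^ (2 * ℓ) := by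
      rw [← pow_add]
      exact pow_lt_pow_right₀ hq1 (by omega)
    obtain ⟨c1, c2, c3, c4, c5⟩ := anisotropic_evalEncode h2 hbal hu hd hD hqQ hLQ hgauss hradQ
      hq3 hY hYN hNr
    clear hYN hNr hradQ hgauss hLQ e1 e2 e3 e4 e5 e6 e7 e8 e9 e10 e11
    generalize (q : ℚ) ^ (ℓ + ε) = Y at *
    generalize (q : ℚ) ^ (2 * ℓ) = N at *
    generalize (q : ℚ) ^ (2 * ε) = r at *
    refine ⟨c2, ?_, c3.trans hm, ?_, ?_⟩
    · field_simp
      linear_combination c1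
    · convert c4 using 1
      simp only [anisotropicWeight, Matrix.cons_val]
      field_simp
      ring
    · convert c5 using 1
      simp only [List.ofFn_succ, List.ofFn_zero, anisotropicWeight, anisotropicFreq,
        Fin.succ_zero_eq_one, Fin.succ_one_eq_two, Fin.reduceSucc, Matrix.cons_val,
        List.cons.injEq, Prod.mk.injEq, and_true, true_and]
      constructorm* _ ∧ _ <;> field_simp <;> ring
  · intro hm0
    have hu : powerTraceForm K L (g * j) (algebraMap K L 2⁻¹) = 0 := by
      rw [hQu, hm, hcast.1 hm0, zero_mul]
    -- Here `Q u = 0`, so `f ≠ 0` has to come from the trace itself being nonzero.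
    have hf : (powerTraceForm K L (g * j)).polarBilin (algebraMap K L 2⁻¹) ≠ 0 := by
      intro h
      apply Algebra.trace_ne_zero K L
      ext y
      rw [← polarBilin_powerTraceForm_algebraMap h2 (g * j), h]
    have hYN : (q : ℚ) * q ^ (ℓ + ε) ≤ q ^ (2 * ℓ) := by
      rw [← pow_succ']
      exact pow_le_pow_right₀ hq1.le (by omega)
    have hNq : (q : ℚ) ^ 2 < q ^ (2 * ℓ) := pow_lt_pow_right₀ hq1 (by omega)
    obtain ⟨c1, c2, c3, c4, c5⟩ := isotropic_evalEncode h2 hbal hu hf hd hD hqQ hLQ hgauss hradQ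
      hq3 hY hYN hNq
    clear hYN hNq hradQ hgauss hLQ e1 e2 e3 e4 e5 e6 e7 e8 e9 e10 e11
    generalize (q : ℚ) ^ (ℓ + ε) = Y at *
    generalize (q : ℚ) ^ (2 * ℓ) = N at *
    generalize (q : ℚ) ^ (2 * ε) = r at *
    refine ⟨c2, ?_, c3.trans hm, ?_, ?_⟩
    · field_simp
      linear_combination c1
    · convert c4 using 1
      simp only [isotropicWeight, Matrix.cons_val]
      ring
    · convert c5 using 1
      simp only [List.ofFn_succ, List.ofFn_zero, isotropicWeight, isotropicFreq,
        Fin.succ_zero_eq_one, Fin.succ_one_eq_two, Fin.reduceSucc, Matrix.cons_val,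
        List.cons.injEq, Prod.mk.injEq, and_true, true_and]
      constructorm* _ ∧ _ <;> field_simp <;> ring
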